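/- Let $P_0$ be a locally compact group and let $\mathbb R^*_+$ act on it by automorphisms $p\mapsto p^r$, jointly continuously in $(r,p)$; let $P=\mathbb R^*_+\ltimes P_0$, with $r\,p\,r^{-1}=p^r$. Let $T$ be a strongly continuous unitary (or, over the reals, orthogonal) representation of $P_0$ in a Hilbert space $H$ that is canonical: there is a unit cyclic vector $h\in H$ such that for each $p\in P_0$ there is a constant $c(p)$ with $\|T(p^r)h-h\|<c(p)\,r$ for all sufficiently small $r>0$. Put $T_r(p)=T(p^r)$. All inner products are linear in the first variable. On functions $f:\mathbb R^*_+\to H$ let $P$ act by $(\widetilde T(p)f)(r)=T_r(p)f(r)$ for $p\in P_0$ and $(\widetilde T(r_0)f)(r)=f(r_0r)$ for $r_0\in\mathbb R^*_+$. Put $f_0(r)=e^{-r/2}h$ and $b(g)=\widetilde T(g)f_0-f_0$. Then, for every $g\in P$, $b(g)\in L^2(\mathbb R^*_+,r^{-1}dr;H)$, and the integral $\langle b(g),f_0\rangle:=\int_0^\infty\langle b(g)(r),f_0(r)\rangle\,r^{-1}dr$ converges absolutely. Let $(X,m)$ be a probability space, and let $P^X$ be the set of bounded measurable maps $X\to P$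 (bounded: with values in a compact set), with pointwise multiplication. Let $l^1_+(X)$ be the set of countable configurations $\xi=\{r_k,x_k\}_{k\ge1}$ (also written $\xi=\sum_k r_k\delta_{x_k}$) with $r_k>0$, $\sum_k r_k<\infty$, $x_k\in X$, taken up to the order of enumeration. Let $\mathcal L$ be the infinite-dimensional Lebesgue measure on $l^1_+(X)$, that is, the measure with density $e^{\sum_k r_k}$ with respect to the law of the Poisson configuration with intensity $r^{-1}e^{-r}\,dr\,dm(x)$. Its Laplace transform is $$\int\exp\Bigl(-\sum_k r_kf(x_k)\Bigr)d\mathcal L(\xi)=\exp\Bigl(-\int_X\log f\,dm\Bigr)$$ for all measurable $f:X\to\mathbb R$ with values between two positive constants. Let $H_\xi=\bigotimes_{k}H_{r_k}$, $H_{r_k}=H$, be the countable tensor product with stabilizing vector $h$, and let $\operatorname{INT}H=\int^\oplus H_\xi\,d\mathcal L(\xi)$ be the Hilbert space of square-integrable measurable sections $F(\xi)\in H_\xi$. The operators of the integral model $U=\operatorname{INT}T$ are given on sections, for $g=p\,r_0\in P^X$ with $p(x)\in P_0$, $r_0(x)\in\mathbb R^*_+$, by $$(U(g)F)(\xi)=e^{\frac12\int_X\log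 r_0\,dm}\;T_\xi(p)\,F(r_0\xi),\qquad T_\xi(p)=\bigotimes_kT_{r_k}(p(x_k)),\qquad r_0\xi=\{r_0(x_k)r_k,x_k\}.$$ Let $\Omega(\xi)=\bigotimes_k e^{-r_k/2}h$. Then $\Omega$ is a unit vector of $\operatorname{INT}H$. For every $g\in P^X$ the section $U(g)\Omega$ belongs to $\operatorname{INT}H$, the function $x\mapsto i\operatorname{Im}\langle b(g(x)),f_0\rangle-\frac12\|b(g(x))\|^2$ is $m$-integrable, and the spherical function of $U$ is $$\langle U(g)\Omega,\Omega\rangle=\exp\int_X\Bigl(i\operatorname{Im}\langle b(g(x)),f_0\rangle-\tfrac12\|b(g(x))\|^2\Bigr)dm(x).$$ (In the real case the term with $i\operatorname{Im}$ is absent.) -/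

import Mathlib

open MeasureTheory Filter Topology
open scoped ENNReal ComplexOrder

namespace IntModel

noncomputable section

/-! ### Infinite tensor products with a stabilizing vector -/

section Tensor

variable (𝕜 : Type*) [RCLike 𝕜] {H : Type*} [NormedAddCommGroup H] [InnerProductSpace 𝕜 H]

/-- Sequences of vectors that are summably close to the stabilizing vector `h`. These are the
sequences whose elementary tensor `⊗ₖ fₖ` is formed below. -/
abbrev Family (h : H) : Type _ := {f : ℕ → H // Summable fun k => ‖f k - h‖}

/-- The inner product `∏ₖ ⟪fₖ, f'ₖ⟫` of two elementary tensors. -/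
def tensorKernel (h : H) : Matrix (Family h) (Family h) 𝕜 :=
  fun f f' => ∏' k, inner 𝕜 (f.1 k) (f'.1 k)

lemma Family.multipliable_inner {h : H} (hh : ‖h‖ = 1) (f f' : Family h) :
    Multipliable fun k => inner 𝕜 (f.1 k) (f'.1 k) := by
  have key : Summable fun k => ‖inner 𝕜 (f.1 k) (f'.1 k) - 1‖ := by
    have h1 : (inner 𝕜 h h : 𝕜) = 1 := by
      rw [inner_self_eq_norm_sq_to_K, hh]; simp
    have hb : ∃ C, ∀ k, ‖f.1 k - h‖ ≤ C := by
      obtain ⟨C, hC⟩ := f.2.tendsto_atTop_zero.bddAbove_range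
      exact ⟨C, fun k => hC ⟨k, rfl⟩⟩
    obtain ⟨C, hC⟩ := hb
    refine Summable.of_nonneg_of_le (fun _ => norm_nonneg _) (fun k => ?_)
      (f.2.add (f'.2.mul_left (C + 1)))
    have e : (inner 𝕜 (f.1 k) (f'.1 k) : 𝕜) - 1
        = inner 𝕜 (f.1 k - h) h + inner 𝕜 (f.1 k) (f'.1 k - h) := by
      rw [inner_sub_left, inner_sub_right, h1]; ring
    have hf : ‖f.1 k‖ ≤ C + 1 := by
      calc ‖f.1 k‖ = ‖(f.1 k - h) + h‖ := by simp
        _ ≤ ‖f.1 k - h‖ + ‖h‖ := norm_add_le _ _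
        _ ≤ C + 1 := by rw [hh]; gcongr; exact hC k
    rw [e]
    refine (norm_add_le _ _).trans (add_le_add ?_ ?_)
    · simpa [hh] using norm_inner_le_norm (𝕜 := 𝕜) (f.1 k - h) h
    · refine (norm_inner_le_norm _ _).trans ?_
      gcongr
  simpa using multipliable_one_add_of_summable key

lemma gram_posSemidef {ι E : Type*} [SeminormedAddCommGroup E] [InnerProductSpace 𝕜 E]
    (v : ι → E) : Matrix.PosSemidef (fun i j => inner 𝕜 (v i) (v j) : Matrix ι ι 𝕜) := by
  refine ⟨?_, fun x => ?_⟩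
  · ext i j
    exact inner_conj_symm _ _
  · have : (x.sum fun i xi => x.sum fun j xj => star xi * inner 𝕜 (v i) (v j) * xj)
        = inner 𝕜 (x.sum fun i xi => xi • v i) (x.sum fun i xi => xi • v i) := by
      simp only [Finsupp.sum, sum_inner]
      refine Finset.sum_congr rfl fun i _ => ?_
      rw [inner_sum]
      refine Finset.sum_congr rfl fun j _ => ?_
      rw [inner_smul_left, inner_smul_right, RCLike.star_def]
      ring
    rw [this, inner_self_eq_norm_sq_to_K]
    exact_mod_cast sq_nonneg ‖x.sum fun i xi => xi • v i‖

lemma tensorKernel_posSemidef {h : H} (hh : ‖h‖ = 1) : (tensorKernel 𝕜 h).PosSemidef := by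
  have hn : ∀ n : ℕ, Matrix.PosSemidef (fun f f' => ∏ k ∈ Finset.range n,
      inner 𝕜 (f.1 k) (f'.1 k) : Matrix (Family h) (Family h) 𝕜) := by
    intro n
    induction n with
    | zero => simpa using gram_posSemidef 𝕜 (fun _ : Family h => (1 : 𝕜))
    | succ n ih =>
      have := ih.hadamard (gram_posSemidef 𝕜 (fun f : Family h => f.1 n))
      refine cast (congrArg Matrix.PosSemidef ?_) this
      funext f f'
      exact (Finset.prod_range_succ _ _).symm
  have hlim : ∀ f f' : Family h, Tendsto
      (fun n => ∏ k ∈ Finset.range n, inner 𝕜 (f.1 k) (f'.1 k)) atTop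
      (𝓝 (tensorKernel 𝕜 h f f')) :=
    fun f f' => (Family.multipliable_inner 𝕜 hh f f').hasProd.tendsto_prod_nat
  refine ⟨?_, fun x => ?_⟩
  · ext f f'
    refine tendsto_nhds_unique (hlim f' f).star ?_
    refine (hlim f f').congr fun n => ?_
    exact ((hn n).1.apply f f').symm
  · refine ge_of_tendsto (b := (0 : 𝕜)) (x := atTop) (f := fun n : ℕ => x.sum fun i xi =>
      x.sum fun j xj => star xi * (∏ k ∈ Finset.range n, inner 𝕜 (i.1 k) (j.1 k)) * xj) ?_
      (Eventually.of_forall fun n => (hn n).2 x)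
    refine tendsto_finsetSum _ fun i _ => tendsto_finsetSum _ fun j _ => ?_
    exact ((hlim i j).const_mul _).mul_const _

/-- The sesquilinear extension of `⟪⊗ fₖ, ⊗ f'ₖ⟫ = ∏ₖ ⟪fₖ, f'ₖ⟫` to formal finite linear
combinations of elementary tensors. -/
def tensorForm {h : H} (u v : Family h →₀ 𝕜) : 𝕜 :=
  u.sum fun f a => v.sum fun f' b => star a * tensorKernel 𝕜 h f f' * b

lemma tensorForm_mapDomain {h : H} (a : Family h → Family h)
    (ha : ∀ f f', tensorKernel 𝕜 h (a f) (a f') = tensorKernel 𝕜 h f f')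
    (u v : Family h →₀ 𝕜) :
    tensorForm 𝕜 (u.mapDomain a) (v.mapDomain a) = tensorForm 𝕜 u v := by
  unfold tensorForm
  rw [Finsupp.sum_mapDomain_index (by simp)
    (by intro f b c; simp only [star_add, add_mul, Finsupp.sum_add])]
  refine Finsupp.sum_congr fun f _ => ?_
  rw [Finsupp.sum_mapDomain_index (by simp) (by intro f b c; rw [mul_add])]
  simp [ha]

/-- The core of the pre-Hilbert structure on formal combinations of elementary tensors. -/
@[reducible] def tensorCore {h : H} (hh : ‖h‖ = 1) :
    PreInnerProductSpace.Core 𝕜 (Family h →₀ 𝕜) where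
  inner u v := tensorForm 𝕜 u v
  conj_inner_symm u v := by
    simp only [tensorForm]
    rw [Finsupp.sum_comm]
    simp only [map_finsuppSum]
    refine Finsupp.sum_congr fun f _ => Finsupp.sum_congr fun f' _ => ?_
    rw [← (tensorKernel_posSemidef 𝕜 hh).1.apply f f']
    simp [mul_comm, mul_left_comm]
  re_inner_nonneg u := (RCLike.nonneg_iff.1 ((tensorKernel_posSemidef 𝕜 hh).2 u)).1
  add_left u v w := by
    refine Finsupp.sum_add_index' (by simp) ?_
    intro f a b
    simp only [star_add, add_mul, Finsupp.sum_add]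
  smul_left u v c := by
    refine (Finsupp.sum_smul_index (by simp)).trans ?_
    simp [tensorForm, Finsupp.mul_sum, ← mul_assoc]

/-- Formal finite linear combinations of elementary tensors, with the semi-inner product in which
`⟪⊗ fₖ, ⊗ f'ₖ⟫ = ∏ₖ ⟪fₖ, f'ₖ⟫`. -/
def PreTensor (h : {h : H // ‖h‖ = 1}) : Type _ := Family h.1 →₀ 𝕜

variable (h : {h : H // ‖h‖ = 1})

instance : AddCommGroup (PreTensor 𝕜 h) := inferInstanceAs (AddCommGroup (Family h.1 →₀ 𝕜))
instance : Module 𝕜 (PreTensor 𝕜 h) := inferInstanceAs (Module 𝕜 (Family h.1 →₀ 𝕜))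

instance preTensorCore : PreInnerProductSpace.Core 𝕜 (PreTensor 𝕜 h) := tensorCore 𝕜 h.2

instance : SeminormedAddCommGroup (PreTensor 𝕜 h) :=
  InnerProductSpace.Core.toSeminormedAddCommGroup (𝕜 := 𝕜)

instance : InnerProductSpace 𝕜 (PreTensor 𝕜 h) := .ofCore _

/-- The countable tensor product `⊗ₖ H` with stabilizing unit vector `h`: the Hilbert space
spanned by the elementary tensors, with `⟪⊗ fₖ, ⊗ f'ₖ⟫ = ∏ₖ ⟪fₖ, f'ₖ⟫`. (Each `⊗ fₖ` is the limit
of the vectors `f₀ ⊗ ⋯ ⊗ fₙ ⊗ h ⊗ h ⊗ ⋯`, so this is the completion of the inductive limit of the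
finite tensor products under the embeddings `x ↦ x ⊗ h`.) -/
abbrev InfTensor : Type _ := UniformSpace.Completion (PreTensor 𝕜 h)

variable {h}

/-- The formal elementary tensor of a family. -/
def PreTensor.of (f : Family h.1) : PreTensor 𝕜 h := (Finsupp.single f (1 : 𝕜) : Family h.1 →₀ 𝕜)

/-- The elementary tensor `⊗ₖ fₖ`. -/
def tmk (f : Family h.1) : InfTensor 𝕜 h := (PreTensor.of 𝕜 f : PreTensor 𝕜 h)

lemma inner_tmk (f f' : Family h.1) :
    inner 𝕜 (tmk 𝕜 f) (tmk 𝕜 f') = ∏' k, inner 𝕜 (f.1 k) (f'.1 k) := by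
  rw [tmk, tmk, UniformSpace.Completion.inner_coe]
  change tensorForm 𝕜 (Finsupp.single f (1 : 𝕜)) (Finsupp.single f' (1 : 𝕜)) = _
  simp [tensorForm, tensorKernel]

/-- A map of families that preserves the kernel, extended linearly to formal combinations. -/
def preMap (a : Family h.1 → Family h.1)
    (ha : ∀ f f', tensorKernel 𝕜 h.1 (a f) (a f') = tensorKernel 𝕜 h.1 f f') :
    PreTensor 𝕜 h →ₗᵢ[𝕜] PreTensor 𝕜 h :=
  LinearMap.isometryOfInner (E := PreTensor 𝕜 h) (E' := PreTensor 𝕜 h)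
    (Finsupp.lmapDomain 𝕜 𝕜 a : (Family h.1 →₀ 𝕜) →ₗ[𝕜] (Family h.1 →₀ 𝕜))
    (fun u v => tensorForm_mapDomain 𝕜 a ha u v)

/-- The isometric operator on the infinite tensor product with `⊗ f ↦ ⊗ (a f)`. -/
def tensorMap (a : Family h.1 → Family h.1)
    (ha : ∀ f f', tensorKernel 𝕜 h.1 (a f) (a f') = tensorKernel 𝕜 h.1 f f') :
    InfTensor 𝕜 h →L[𝕜] InfTensor 𝕜 h :=
  (preMap 𝕜 a ha).toContinuousLinearMap.completion

lemma tensorMap_tmk (a : Family h.1 → Family h.1)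
    (ha : ∀ f f', tensorKernel 𝕜 h.1 (a f) (a f') = tensorKernel 𝕜 h.1 f f') (f : Family h.1) :
    tensorMap 𝕜 a ha (tmk 𝕜 f) = tmk 𝕜 (a f) := by
  refine (ContinuousLinearMap.completion_apply_coe _ _).trans ?_
  exact congrArg (UniformSpace.Completion.coe' (α := PreTensor 𝕜 h))
    (Finsupp.mapDomain_single (f := a) (a := f) (b := (1 : 𝕜)))

/-- Reindexing of a family by a permutation. -/
def Family.reindex (σ : Equiv.Perm ℕ) (f : Family h.1) : Family h.1 :=
  ⟨fun k => f.1 (σ k), σ.summable_iff.2 f.2⟩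

lemma tensorKernel_reindex (σ : Equiv.Perm ℕ) (f f' : Family h.1) :
    tensorKernel 𝕜 h.1 (f.reindex σ) (f'.reindex σ) = tensorKernel 𝕜 h.1 f f' :=
  σ.tprod_eq fun k => inner 𝕜 (f.1 k) (f'.1 k)

/-- The permutation `⊗ₖ fₖ ↦ ⊗ₖ f_{σ(k)}` of the tensor factors. -/
def permOp (σ : Equiv.Perm ℕ) : InfTensor 𝕜 h →L[𝕜] InfTensor 𝕜 h :=
  tensorMap 𝕜 (Family.reindex σ) (tensorKernel_reindex 𝕜 σ)

variable {𝕜}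

/-- The family `(Aₖ fₖ)ₖ`. -/
def Family.act (A : ℕ → H ≃ₗᵢ[𝕜] H) (hA : Summable fun k => ‖A k h.1 - h.1‖)
    (f : Family h.1) : Family h.1 :=
  ⟨fun k => A k (f.1 k), by
    refine Summable.of_nonneg_of_le (fun _ => norm_nonneg _) (fun k => ?_) (f.2.add hA)
    calc ‖A k (f.1 k) - h.1‖ = ‖A k (f.1 k - h.1) + (A k h.1 - h.1)‖ := by simp
      _ ≤ ‖f.1 k - h.1‖ + ‖A k h.1 - h.1‖ := by
        rw [← (A k).norm_map (f.1 k - h.1)]; exact norm_add_le _ _⟩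

lemma tensorKernel_act (A : ℕ → H ≃ₗᵢ[𝕜] H) (hA : Summable fun k => ‖A k h.1 - h.1‖)
    (f f' : Family h.1) :
    tensorKernel 𝕜 h.1 (f.act A hA) (f'.act A hA) = tensorKernel 𝕜 h.1 f f' := by
  simp [tensorKernel, Family.act]

open Classical in
/-- The operator `⊗ₖ Aₖ`, i.e. `⊗ₖ fₖ ↦ ⊗ₖ Aₖ fₖ`, for isometries with `∑ ‖Aₖ h - h‖ < ∞`
(and, as a convention that is never used below, the identity if the series diverges). -/
def tensorOp (A : ℕ → H ≃ₗᵢ[𝕜] H) : InfTensor 𝕜 h →L[𝕜] InfTensor 𝕜 h :=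
  if hA : Summable fun k => ‖A k h.1 - h.1‖ then
    tensorMap 𝕜 (Family.act A hA) (tensorKernel_act A hA)
  else ContinuousLinearMap.id 𝕜 _

end Tensor

/-! ### The cone of atomic measures and the infinite-dimensional Lebesgue measure -/

/-- The multiplicative group `ℝ*₊` of positive reals. -/
abbrev Rpos : Type := {r : ℝ // 0 < r}

/-- Lebesgue measure `dr` on `ℝ*₊`. -/
def lebPos : Measure Rpos := (volume : Measure ℝ).comap Subtype.val

/-- The multiplicative Haar measure `r⁻¹ dr` on `ℝ*₊`. -/
def haarPos : Measure Rpos :=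
  lebPos.withDensity fun r => ENNReal.ofReal (r : ℝ)⁻¹

/-- The exponential law `e^{-r} dr` on `ℝ*₊`. -/
def expLaw : Measure Rpos :=
  lebPos.withDensity fun r => ENNReal.ofReal (Real.exp (-(r : ℝ)))

instance : IsProbabilityMeasure expLaw := by
  constructor
  have h1 : ∫⁻ r : Rpos, ENNReal.ofReal (Real.exp (-(r : ℝ))) ∂lebPos
      = ∫⁻ r in Set.Ioi (0 : ℝ), ENNReal.ofReal (Real.exp (-r)) :=
    lintegral_subtype_comap (s := Set.Ioi (0 : ℝ)) measurableSet_Ioi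
      (fun r => ENNReal.ofReal (Real.exp (-r)))
  rw [expLaw, withDensity_apply _ MeasurableSet.univ, Measure.restrict_univ, h1,
    ← ofReal_integral_eq_lintegral_ofReal (integrableOn_exp_neg_Ioi 0)
      (Eventually.of_forall fun _ => (Real.exp_pos _).le), integral_exp_neg_Ioi_zero]
  simp

/-- Enumerations `(rₖ, xₖ)ₖ` of the elements `ξ = ∑ₖ rₖ δ_{xₖ}` of the cone `l¹₊(X)` of atomic
measures: `rₖ > 0` and `∑ rₖ < ∞`. Two enumerations that differ by a permutation of `ℕ` represent
the same `ξ`. -/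
abbrev Config (X : Type*) : Type _ := {ω : ℕ → Rpos × X // Summable fun k => ((ω k).1 : ℝ)}

section Config

variable {X : Type*}

/-- The weight `rₖ`. -/
def Config.r (ω : Config X) (k : ℕ) : Rpos := (ω.1 k).1

/-- The point `xₖ`. -/
def Config.x (ω : Config X) (k : ℕ) : X := (ω.1 k).2

/-- Another enumeration of the same atomic measure. -/
def Config.reindex (σ : Equiv.Perm ℕ) (ω : Config X) : Config X :=
  ⟨fun k => ω.1 (σ k), σ.summable_iff.2 ω.2⟩

/-- The action `∑ rₖ δ_{xₖ} ↦ ∑ a(xₖ) rₖ δ_{xₖ}` of a bounded positive multiplier. -/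
def Config.scale (a : X → Rpos) (ha : ∃ C : ℝ, ∀ x, (a x : ℝ) ≤ C) (ω : Config X) : Config X :=
  ⟨fun k => (a (ω.x k) * ω.r k, ω.x k), by
    obtain ⟨C, hC⟩ := ha
    refine Summable.of_nonneg_of_le (fun k => (a (ω.x k) * ω.r k).2.le) (fun k => ?_)
      (ω.2.mul_left C)
    exact mul_le_mul_of_nonneg_right (hC _) (ω.r k).2.le⟩

/-- From independent standard exponential variables `Eₖ, Vₖ` and points `xₖ`, the sequence
`(e^{-(E₀ + ⋯ + Eₖ)} Vₖ, xₖ)ₖ`. -/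
def gammaPoints (η : ℕ → (Rpos × Rpos) × X) : ℕ → Rpos × X := fun k =>
  (⟨Real.exp (-∑ j ∈ Finset.range (k + 1), ((η j).1.1 : ℝ)) * (η k).1.2,
    mul_pos (Real.exp_pos _) (η k).1.2.2⟩, (η k).2)

variable [MeasurableSpace X]

/-- The law on `l¹₊(X)` of the gamma process over `(X, m)`, that is, of the Poisson configuration
`{(rₖ, xₖ)}` with intensity `r⁻¹ e^{-r} dr dm(x)`, enumerated as in `gammaPoints`. (The points
`(E₀ + ⋯ + Eₖ, Vₖ)` form a Poisson process with intensity `e^{-v} dt dv`, which `(t, v) ↦ e^{-t} v`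
takes to the Poisson process with intensity `r⁻¹ e^{-r} dr`.) -/
def gammaMeasure (m : Measure X) : Measure (Config X) :=
  ((Measure.infinitePi fun _ : ℕ => (expLaw.prod expLaw).prod m).map gammaPoints).comap
    Subtype.val

/-- The infinite-dimensional Lebesgue measure `𝓛` on `l¹₊(X)`. It has the density `e^{∑ rₖ}` with
respect to the law of the gamma process. -/
def lebesgueInf (m : Measure X) : Measure (Config X) :=
  (gammaMeasure m).withDensity fun ω => ENNReal.ofReal (Real.exp (∑' k, (ω.r k : ℝ)))

end Config

/-! ### The groups, the canonical representation and its special representation -/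

section Rep

variable {𝕜 : Type*} [RCLike 𝕜] {H : Type*} [NormedAddCommGroup H] [InnerProductSpace 𝕜 H]
variable {P₀ : Type*} [Group P₀]

/-- `T` is canonical with respect to the automorphisms `g ↦ g^r = α r g`, with the almost invariant
unit vector `h`: the vector `h` is cyclic, and `‖T(g^r)h - h‖ < c(g) r` for small `r`. -/
def IsCanonical (α : Rpos →* MulAut P₀) (T : P₀ →* (H ≃ₗᵢ[𝕜] H)) (h : {h : H // ‖h‖ = 1}) : Prop :=
  (Submodule.span 𝕜 (Set.range fun g => T g h.1)).topologicalClosure = ⊤ ∧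
  ∀ g : P₀, ∃ c δ : ℝ, 0 < δ ∧ ∀ r : Rpos, (r : ℝ) < δ → ‖T (α r g) h.1 - h.1‖ < c * r

/-- The action of `P = ℝ*₊ ⋌ P₀` on sections `f : ℝ*₊ → H`: the operators of `P₀` act by
`(T̃(g) f)(r) = T(g^r) f(r)`, those of `ℝ*₊` by `(T̃(r₀) f)(r) = f(r₀ r)`; the element
`⟨p, r₀⟩` is the product `p r₀`. -/
def specialRep (α : Rpos →* MulAut P₀) (T : P₀ →* (H ≃ₗᵢ[𝕜] H)) (g : P₀ ⋊[α] Rpos)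
    (f : Rpos → H) : Rpos → H :=
  fun r => T (α r g.left) (f (g.right * r))

variable (𝕜) in
/-- The section `f₀(r) = e^{-r/2} h`. -/
def f₀ (h : {h : H // ‖h‖ = 1}) : Rpos → H :=
  fun r => ((Real.exp (-(r : ℝ) / 2) : ℝ) : 𝕜) • h.1

/-- The 1-cocycle `b(g) = T̃(g) f₀ - f₀`. -/
def cocycle (α : Rpos →* MulAut P₀) (T : P₀ →* (H ≃ₗᵢ[𝕜] H)) (h : {h : H // ‖h‖ = 1})
    (g : P₀ ⋊[α] Rpos) : Rpos → H :=
  fun r => specialRep α T g (f₀ 𝕜 h) r - f₀ 𝕜 h r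

/-- `⟨b(g), f₀⟩ = ∫ ⟨b(g)(r), f₀(r)⟩ r⁻¹ dr`, where `⟨·,·⟩` is linear in the first variable. -/
def cocyclePairing (α : Rpos →* MulAut P₀) (T : P₀ →* (H ≃ₗᵢ[𝕜] H)) (h : {h : H // ‖h‖ = 1})
    (g : P₀ ⋊[α] Rpos) : 𝕜 :=
  ∫ r, inner 𝕜 (f₀ 𝕜 h r) (cocycle α T h g r) ∂haarPos

/-- `‖b(g)‖² = ∫ ‖b(g)(r)‖² r⁻¹ dr`. -/
def cocycleNormSq (α : Rpos →* MulAut P₀) (T : P₀ →* (H ≃ₗᵢ[𝕜] H)) (h : {h : H // ‖h‖ = 1})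
    (g : P₀ ⋊[α] Rpos) : ℝ :=
  ∫ r, ‖cocycle α T h g r‖ ^ 2 ∂haarPos

/-- The integrand `i Im ⟨b(g), f₀⟩ - ½ ‖b(g)‖²` (over `ℝ` the first term is zero). -/
def sphericalExponent (α : Rpos →* MulAut P₀) (T : P₀ →* (H ≃ₗᵢ[𝕜] H)) (h : {h : H // ‖h‖ = 1})
    (g : P₀ ⋊[α] Rpos) : 𝕜 :=
  RCLike.I * ((RCLike.im (cocyclePairing α T h g) : ℝ) : 𝕜)
    - ((1 / 2 * cocycleNormSq α T h g : ℝ) : 𝕜)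

end Rep

/-! ### Currents and the integral model -/

/-- An element of `P^X`: a bounded (that is, with relatively compact range) measurable map from `X`
to the group `P = ℝ*₊ ⋌ P₀`, whose space is `P₀ × ℝ*₊`. -/
structure Current {P₀ : Type*} [Group P₀] [TopologicalSpace P₀] [MeasurableSpace P₀]
    (α : Rpos →* MulAut P₀) (X : Type*) [MeasurableSpace X] where
  toFun : X → P₀ ⋊[α] Rpos
  measurable_left : Measurable fun x => (toFun x).left
  measurable_right : Measurable fun x => (toFun x).right
  bounded : ∃ K : Set (P₀ × Rpos), IsCompact K ∧ ∀ x, ((toFun x).left, (toFun x).right) ∈ K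

section Model

variable {𝕜 : Type*} [RCLike 𝕜] {H : Type*} [NormedAddCommGroup H] [InnerProductSpace 𝕜 H]
variable {P₀ : Type*} [Group P₀] [TopologicalSpace P₀] [MeasurableSpace P₀]
variable {X : Type*} [MeasurableSpace X]

lemma Current.exists_right_le {α : Rpos →* MulAut P₀} (g : Current α X) :
    ∃ C : ℝ, ∀ x, ((g.toFun x).right : ℝ) ≤ C := by
  obtain ⟨K, hK, hg⟩ := g.bounded
  obtain ⟨C, hC⟩ := (hK.image (f := fun q : P₀ × Rpos => (q.2 : ℝ)) (by fun_prop)).bddAbove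
  exact ⟨C, fun x => hC ⟨_, hg x, rfl⟩⟩

variable (h : {h : H // ‖h‖ = 1})

/-- A measurable section `ξ ↦ F(ξ) ∈ H_ξ` of the bundle over `l¹₊(X)` with the fibres
`H_ξ = ⊗ₖ H_{rₖ}`: a function of the enumerations of `ξ` with values in `⊗ₖ H`, where a change of
the enumeration permutes the tensor factors. -/
def IsSection (F : Config X → InfTensor 𝕜 h) : Prop :=
  StronglyMeasurable F ∧ ∀ (σ : Equiv.Perm ℕ) (ω : Config X), F (ω.reindex σ) = permOp 𝕜 σ (F ω)

variable (𝕜) in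
/-- The space `INT H = ∫^⊕ H_ξ d𝓛(ξ)`: the square-integrable measurable sections, up to equality
almost everywhere. -/
def intSpace (m : Measure X) : Submodule 𝕜 (Lp (InfTensor 𝕜 h) 2 (lebesgueInf m)) where
  carrier := {u | ∃ F : Config X → InfTensor 𝕜 h, IsSection h F ∧ u =ᵐ[lebesgueInf m] F}
  zero_mem' := ⟨0, ⟨stronglyMeasurable_zero, fun _ _ => by simp⟩, Lp.coeFn_zero _ _ _⟩
  add_mem' := by
    rintro u v ⟨F, hF, hu⟩ ⟨G, hG, hv⟩
    refine ⟨F + G, ⟨hF.1.add hG.1, fun σ ω => ?_⟩, (Lp.coeFn_add u v).trans (hu.add hv)⟩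
    simp [hF.2 σ ω, hG.2 σ ω]
  smul_mem' := by
    rintro c u ⟨F, hF, hu⟩
    refine ⟨c • F, ⟨hF.1.const_smul c, fun σ ω => ?_⟩,
      (Lp.coeFn_smul c u).trans (hu.const_smul c)⟩
    simp [hF.2 σ ω]

/-- A square-integrable measurable section. -/
def IsSqSection (m : Measure X) (F : Config X → InfTensor 𝕜 h) : Prop :=
  IsSection h F ∧ MemLp F 2 (lebesgueInf m)

variable {h}

/-- The vector of `INT H` given by a square-integrable section. -/
def IsSqSection.toInt {m : Measure X} {F : Config X → InfTensor 𝕜 h} (hF : IsSqSection h m F) :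
    intSpace 𝕜 h m :=
  ⟨hF.2.toLp F, F, hF.1, hF.2.coeFn_toLp⟩

/-- The operators of the integral model `U = INT T` on sections,
`(U(g)F)(ξ) = e^{½ ∫ log r₀(x) dm(x)} T_ξ(p) F(r₀ ξ)` for the current `g = p r₀`, where
`T_ξ(p) = ⊗ₖ T_{rₖ}(p(xₖ))` and `T_r(p) = T(p^r)`. -/
def intRep (α : Rpos →* MulAut P₀) (T : P₀ →* (H ≃ₗᵢ[𝕜] H)) (m : Measure X) (g : Current α X)
    (F : Config X → InfTensor 𝕜 h) : Config X → InfTensor 𝕜 h := fun ω =>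
  ((Real.exp (1 / 2 * ∫ x, Real.log (g.toFun x).right ∂m) : ℝ) : 𝕜) •
    tensorOp (fun k => T (α (ω.r k) (g.toFun (ω.x k)).left))
      (F (ω.scale (fun x => (g.toFun x).right) g.exists_right_le))

variable (𝕜) (h) in
/-- The section `Ω(ξ) = ⊗ₖ e^{-rₖ/2} h`. -/
def vacuum (ω : Config X) : InfTensor 𝕜 h :=
  tmk 𝕜 ⟨fun k => f₀ 𝕜 h (ω.r k), by
    refine Summable.of_nonneg_of_le (fun _ => norm_nonneg _) (fun k => ?_) ω.2
    have h0 : (0 : ℝ) < ω.r k := (ω.r k).2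
    have h1 : Real.exp (-(ω.r k : ℝ) / 2) ≤ 1 := Real.exp_le_one_iff.2 (by linarith)
    have h2 : -(ω.r k : ℝ) / 2 + 1 ≤ Real.exp (-(ω.r k : ℝ) / 2) := Real.add_one_le_exp _
    have e : f₀ 𝕜 h (ω.r k) - h.1
        = ((Real.exp (-(ω.r k : ℝ) / 2) - 1 : ℝ) : 𝕜) • h.1 := by
      rw [f₀, RCLike.ofReal_sub, sub_smul]; simp
    change _ ≤ (ω.r k : ℝ)
    rw [e, norm_smul, h.2, RCLike.norm_ofReal, abs_of_nonpos (by linarith)]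
    linarith⟩

end Model

end

end IntModel

open IntModel

/-!
The spherical function of the integral model is computed by Campbell's formula for the gamma
process: for a function `F(r, x)` with `|F| ≤ e^{κ r}`, `κ < 1`, and `|F - 1| ≤ C r e^{κ r}`,

  `E ∏ₖ F(rₖ, xₖ) = exp (∫∫ (F(r, x) - 1) r⁻¹ e^{-r} dr dm(x))`

(`IsGammaMultiplier.integral_tprod`). The formula is obtained from the enumeration
`rₖ = e^{-(E₀ + ⋯ + Eₖ)} Vₖ` of the process. Conditioning on the first point shows that the means
`uₙ(τ)` of the partial products `∏_{k < n} F(e^{-τ} rₖ, xₖ)` satisfy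
`uₙ₊₁(τ) = ∫₀^∞ e^{-s} g(τ + s) uₙ(τ + s) ds`, where `g(τ) = E F(e^{-τ} V, x)`
(`IsGammaMultiplier.prodMean_succ`). The function `exp (∫_τ^∞ (g - 1))` is a fixed point of this
recursion, and since `|g(τ) - 1| ≤ C e^{-τ}` the recursion is a contraction by `1/2` in a suitable
weighted norm (`tendsto_exp_of_recursion`). The exponent is rewritten by means of the fact that
`(τ, v) ↦ e^{-τ} v` takes `dτ × e^{-v} dv` to `r⁻¹ e^{-r} dr` (`measurePreserving_expNeg_mul`). The
multiplier `F = e^{κ r}` has bounded partial products, which yields summability of the weights and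
the domination needed to pass to the infinite product.

With `F = e^{(1 - f(x)) r}` and Frullani's integral this is the Laplace transform of `𝓛`
(`lintegral_lebesgueInf`).

For a current `g = p r₀` the function `⟪U(g)Ω, Ω⟫` at a configuration, times the density `e^{∑ rₖ}`
of `𝓛`, is `e^{½ ∫ log r₀}` times the product of the factors
`F(r, x) = e^{(1 - r₀(x)) r / 2} ⟪T(p(x)^r) h, h⟫` (`inner_vacuum_intRep_vacuum`). On the other hand
`⟨b(g), f₀⟩ = ∫ (F - 1) r⁻¹ e^{-r} dr` and `‖b(g)‖² = -log r₀ - 2 Re ⟨b(g), f₀⟩`, again by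
Frullani's integral, so that the exponents agree (`sphericalExponent_eq`).

The bound `|F - 1| ≤ C r e^{κ r}` has to be uniform in `x`. The constants in the definition of a
canonical representation are subadditive in the group element, and Baire's theorem makes them
bounded on compact sets (`IsCanonical.exists_isAlmostInvariant_of_isCompact`).
-/

namespace IntModel

open Set

/-! ### Independent sequences -/

/-- The sequence `a, η₀, η₁, …`. -/
def natCons {A : Type*} (a : A) (η : ℕ → A) : ℕ → A
  | 0 => a
  | k + 1 => η k

/-- Prepending an independent variable with the law `μ` to an i.i.d. sequence with that law gives
again such a sequence. -/
lemma measurePreserving_natCons {A : Type*} [MeasurableSpace A] (μ : Measure A)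
    [IsProbabilityMeasure μ] :
    MeasurePreserving (fun p : A × (ℕ → A) => natCons p.1 p.2)
      (μ.prod (Measure.infinitePi fun _ => μ)) (Measure.infinitePi fun _ => μ) := by
  have hm : Measurable (fun p : A × (ℕ → A) => natCons p.1 p.2) := by
    refine measurable_pi_lambda _ fun k => ?_
    cases k
    · exact measurable_fst
    · exact (measurable_pi_apply _).comp measurable_snd
  refine ⟨hm, Measure.eq_infinitePi _ fun s t ht => ?_⟩
  classical
  let s' : Finset ℕ := s.preimage Nat.succ (Nat.succ_injective.injOn)
  let t₀ : Set A := if 0 ∈ s then t 0 else univ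
  have e : (fun p : A × (ℕ → A) => natCons p.1 p.2) ⁻¹' (Set.pi s t)
      = t₀ ×ˢ Set.pi s' (fun k => t (k + 1)) := by
    ext ⟨a, η⟩
    simp only [mem_preimage, Set.mem_pi, mem_prod, Finset.mem_coe]
    constructor
    · intro H
      refine ⟨?_, fun k hk => H (k + 1) (by simpa [s'] using hk)⟩
      by_cases h0 : 0 ∈ s
      · simpa [t₀, h0, natCons] using H 0 h0
      · simp [t₀, h0]
    · rintro ⟨H0, H⟩ (_ | k) hk
      · simpa [t₀, hk, natCons] using H0
      · exact H k (by simpa [s'] using hk)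
  rw [Measure.map_apply hm (MeasurableSet.pi s.countable_toSet fun i _ => ht i), e,
    Measure.prod_prod, Measure.infinitePi_pi _ (fun i _ => ht _)]
  have e2 : ∏ i ∈ s', μ (t (i + 1)) = ∏ i ∈ s.erase 0, μ (t i) := by
    refine Finset.prod_bij (fun k _ => k + 1) ?_ ?_ ?_ ?_
    · intro k hk; simpa [s'] using hk
    · intro a _ b _ hab; simpa using hab
    · rintro (_ | b) hb
      · simp at hb
      · exact ⟨b, by simpa [s'] using hb, rfl⟩
    · simp
  rw [e2]
  by_cases h0 : 0 ∈ s
  · simp only [t₀, h0, if_true]; exact Finset.mul_prod_erase s (fun i => μ (t i)) h0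
  · simp [t₀, h0]

/-! ### A Volterra recursion -/

section Volterra

variable {𝕜 : Type*} [RCLike 𝕜] {g : ℝ → 𝕜} {C : ℝ}

lemma integrableOn_Ioi_of_norm_le_exp (hg : ContinuousOn g (Ici 0))
    (hg1 : ∀ τ, 0 ≤ τ → ‖g τ - 1‖ ≤ C * Real.exp (-τ)) {τ : ℝ} (hτ : 0 ≤ τ) :
    IntegrableOn (fun s => g s - 1) (Ioi τ) := by
  have h1 : IntegrableOn (fun s => C * Real.exp (-s)) (Ioi τ) :=
    (integrableOn_exp_neg_Ioi τ).const_mul C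
  refine Integrable.mono' h1 ?_ ?_
  · exact ((hg.sub continuousOn_const).mono
      (fun s hs => hτ.trans (mem_Ioi.1 hs).le)).aestronglyMeasurable measurableSet_Ioi
  · exact (ae_restrict_mem measurableSet_Ioi).mono fun s hs => hg1 s (hτ.trans (mem_Ioi.1 hs).le)

lemma norm_integral_Ioi_sub_one_le (hg1 : ∀ τ, 0 ≤ τ → ‖g τ - 1‖ ≤ C * Real.exp (-τ))
    {τ : ℝ} (hτ : 0 ≤ τ) : ‖∫ s in Ioi τ, (g s - 1)‖ ≤ C * Real.exp (-τ) := by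
  have h1 : IntegrableOn (fun s => C * Real.exp (-s)) (Ioi τ) :=
    (integrableOn_exp_neg_Ioi τ).const_mul C
  refine (norm_integral_le_of_norm_le h1 ?_).trans_eq ?_
  · exact (ae_restrict_mem measurableSet_Ioi).mono fun s hs => hg1 s (hτ.trans (mem_Ioi.1 hs).le)
  · rw [integral_const_mul, integral_exp_neg_Ioi]

lemma hasDerivAt_integral_Ioi_sub_one (hg : ContinuousOn g (Ici 0))
    (hg1 : ∀ τ, 0 ≤ τ → ‖g τ - 1‖ ≤ C * Real.exp (-τ)) {τ : ℝ} (hτ : 0 < τ) :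
    HasDerivAt (fun τ => ∫ s in Ioi τ, (g s - 1)) (-(g τ - 1)) τ := by
  have hint := integrableOn_Ioi_of_norm_le_exp hg hg1 le_rfl
  have hc : ContinuousOn (fun s => g s - 1) (Ici 0) := hg.sub continuousOn_const
  have e : (fun τ => ∫ s in Ioi τ, (g s - 1)) =ᶠ[𝓝 τ]
      fun τ => (∫ s in Ioi 0, (g s - 1)) - ∫ s in (0 : ℝ)..τ, (g s - 1) := by
    filter_upwards [lt_mem_nhds hτ] with t ht
    rw [eq_sub_iff_add_eq', intervalIntegral.integral_of_le ht.le, ← setIntegral_union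
      (Ioc_disjoint_Ioi le_rfl) measurableSet_Ioi (hint.mono_set Ioc_subset_Ioi_self)
      (hint.mono_set (Ioi_subset_Ioi ht.le)), Ioc_union_Ioi_eq_Ioi ht.le]
  refine HasDerivAt.congr_of_eventuallyEq ?_ e
  refine HasDerivAt.const_sub _ (intervalIntegral.integral_hasDerivAt_right ?_ ?_ ?_)
  · rw [intervalIntegrable_iff_integrableOn_Ioc_of_le hτ.le]
    exact hint.mono_set Ioc_subset_Ioi_self
  · exact (hc.mono Ioi_subset_Ici_self).stronglyMeasurableAtFilter isOpen_Ioi _ hτ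
  · exact hc.continuousAt (Ici_mem_nhds hτ)

lemma continuousWithinAt_integral_Ioi_sub_one (hg : ContinuousOn g (Ici 0))
    (hg1 : ∀ τ, 0 ≤ τ → ‖g τ - 1‖ ≤ C * Real.exp (-τ)) {τ : ℝ} (hτ : 0 ≤ τ) :
    ContinuousWithinAt (fun τ => ∫ s in Ioi τ, (g s - 1)) (Ici τ) τ := by
  have hint := integrableOn_Ioi_of_norm_le_exp hg hg1 le_rfl
  have hint' := hint.mono_set (Ioi_subset_Ioi hτ)
  have e : ∀ t ∈ Ici τ, (∫ s in Ioi t, (g s - 1)) =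
      (∫ s in Ioi τ, (g s - 1)) - ∫ s in τ..t, (g s - 1) := by
    intro t ht
    rw [eq_sub_iff_add_eq', intervalIntegral.integral_of_le ht, ← setIntegral_union
      (Ioc_disjoint_Ioi le_rfl) measurableSet_Ioi (hint'.mono_set Ioc_subset_Ioi_self)
      (hint'.mono_set (Ioi_subset_Ioi ht)), Ioc_union_Ioi_eq_Ioi ht]
  refine ContinuousWithinAt.congr ?_ e (e τ self_mem_Ici)
  refine continuousWithinAt_const.sub ?_
  have h1 : ContinuousOn (fun t => ∫ s in τ..t, (g s - 1)) (Icc τ (τ + 1)) := by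
    rw [← uIcc_of_le (by linarith : τ ≤ τ + 1)]
    refine intervalIntegral.continuousOn_primitive_interval (μ := volume) ?_
    rw [uIcc_of_le (by linarith), integrableOn_Icc_iff_integrableOn_Ioc]
    exact hint'.mono_set Ioc_subset_Ioi_self
  exact ((h1 τ (by simp)).mono_of_mem_nhdsWithin (Icc_mem_nhdsGE (by linarith)))

lemma exists_norm_exp_sub_one_le (𝕜 : Type*) [RCLike 𝕜] (R : ℝ) :
    ∃ M : ℝ, ∀ z : 𝕜, ‖z‖ ≤ R → ‖NormedSpace.exp z - 1‖ ≤ M * ‖z‖ := by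
  have hc : Continuous (NormedSpace.exp : 𝕜 → 𝕜) :=
    continuous_iff_continuousAt.2 fun z => (hasDerivAt_exp (x := z)).continuousAt
  obtain ⟨M, hM⟩ := (isCompact_closedBall (0 : 𝕜) R).exists_bound_of_continuousOn hc.continuousOn
  refine ⟨M, fun z hz => ?_⟩
  have hR : 0 ≤ R := (norm_nonneg z).trans hz
  have := (convex_closedBall (0 : 𝕜) R).norm_image_sub_le_of_norm_hasDerivWithin_le
    (fun w _ => (hasDerivAt_exp (x := w)).hasDerivWithinAt) hM (x := 0) (y := z)
    (by simpa using hR) (by simpa using hz)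
  simpa using this

variable (g) in
/-- `U(τ) = exp (∫_τ^∞ (g - 1))`, the solution of `U' = (1 - g) U`, `U(∞) = 1`. -/
noncomputable def expTail (τ : ℝ) : 𝕜 := NormedSpace.exp (∫ s in Ioi τ, (g s - 1))

lemma exists_norm_expTail_sub_one_le (hC : 0 ≤ C)
    (hg1 : ∀ τ, 0 ≤ τ → ‖g τ - 1‖ ≤ C * Real.exp (-τ)) :
    ∃ D, 0 ≤ D ∧ ∀ τ, 0 ≤ τ → ‖expTail g τ - 1‖ ≤ D * Real.exp (-τ) := by
  obtain ⟨M, hM⟩ := exists_norm_exp_sub_one_le 𝕜 C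
  refine ⟨|M| * C, by positivity, fun τ hτ => ?_⟩
  have h1 := norm_integral_Ioi_sub_one_le hg1 hτ
  have h2 : C * Real.exp (-τ) ≤ C := mul_le_of_le_one_right hC (Real.exp_le_one_iff.2 (by linarith))
  refine (hM _ (h1.trans h2)).trans ?_
  calc M * ‖∫ s in Ioi τ, (g s - 1)‖ ≤ |M| * (C * Real.exp (-τ)) := by
        gcongr; exact le_abs_self M
    _ = _ := by ring

lemma continuousOn_expTail (hg : ContinuousOn g (Ici 0))
    (hg1 : ∀ τ, 0 ≤ τ → ‖g τ - 1‖ ≤ C * Real.exp (-τ)) : ContinuousOn (expTail g) (Ioi 0) :=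
  fun _ hτ => ((hasDerivAt_exp (𝕂 := 𝕜)).continuousAt.comp
    (hasDerivAt_integral_Ioi_sub_one hg hg1 hτ).continuousAt).continuousWithinAt

/-- `U` is the fixed point of the recursion `u ↦ ∫₀^∞ e^{-s} g(τ + s) u(τ + s) ds`, because
`-e^{-s} U(τ + s)` is an antiderivative of the integrand. -/
lemma integral_expTail (hC : 0 ≤ C) (hg : ContinuousOn g (Ici 0))
    (hg1 : ∀ τ, 0 ≤ τ → ‖g τ - 1‖ ≤ C * Real.exp (-τ)) {τ : ℝ} (hτ : 0 ≤ τ) :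
    IntegrableOn (fun s => Real.exp (-s) • (g (τ + s) * expTail g (τ + s))) (Ioi 0) ∧
    ∫ s in Ioi 0, Real.exp (-s) • (g (τ + s) * expTail g (τ + s)) = expTail g τ := by
  obtain ⟨D, hD, hU⟩ := exists_norm_expTail_sub_one_le hC hg1
  have hexp : ∀ t : ℝ, 0 ≤ t → Real.exp (-t) ≤ 1 := fun t ht => Real.exp_le_one_iff.2 (by linarith)
  have hUb : ∀ t, 0 ≤ t → ‖expTail g t‖ ≤ D + 1 := fun t ht => by
    calc ‖expTail g t‖ = ‖(expTail g t - 1) + 1‖ := by simp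
      _ ≤ D + 1 := (norm_add_le _ _).trans (by
        rw [norm_one]; gcongr
        exact (hU t ht).trans (mul_le_of_le_one_right hD (hexp t ht)))
  have hgb : ∀ t, 0 ≤ t → ‖g t‖ ≤ C + 1 := fun t ht => by
    calc ‖g t‖ = ‖(g t - 1) + 1‖ := by simp
      _ ≤ C + 1 := (norm_add_le _ _).trans (by
        rw [norm_one]; gcongr
        exact (hg1 t ht).trans (mul_le_of_le_one_right hC (hexp t ht)))
  have hshift : MapsTo (fun s => τ + s) (Ioi 0) (Ioi 0) := fun s hs => by
    have : (0:ℝ) < s := hs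
    exact mem_Ioi.2 (by linarith)
  have hint : IntegrableOn (fun s => Real.exp (-s) • (g (τ + s) * expTail g (τ + s))) (Ioi 0) := by
    refine Integrable.mono' (g := fun s => ((C + 1) * (D + 1)) * Real.exp (-s))
      ((integrableOn_exp_neg_Ioi 0).const_mul _) ?_ ?_
    · refine ContinuousOn.aestronglyMeasurable ?_ measurableSet_Ioi
      refine (by fun_prop : Continuous fun s : ℝ => Real.exp (-s)).continuousOn.smul ?_
      exact ((hg.mono Ioi_subset_Ici_self).comp (by fun_prop) hshift).mul
        ((continuousOn_expTail hg hg1).comp (by fun_prop) hshift)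
    · filter_upwards [ae_restrict_mem measurableSet_Ioi] with s hs
      have hs' : 0 ≤ τ + s := (hshift hs).le
      rw [norm_smul, norm_mul, Real.norm_of_nonneg (Real.exp_pos _).le, mul_comm]
      gcongr
      · exact hgb _ hs'
      · exact hUb _ hs'
  refine ⟨hint, ?_⟩
  have := integral_Ioi_of_hasDerivAt_of_tendsto (a := 0) (m := (0 : 𝕜))
    (f := fun s => -(Real.exp (-s) • expTail g (τ + s)))
    (f' := fun s => Real.exp (-s) • (g (τ + s) * expTail g (τ + s))) ?_ ?_ hint ?_
  · simpa using this
  · refine ContinuousWithinAt.neg (ContinuousWithinAt.smul (by fun_prop) ?_)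
    have h1 := continuousWithinAt_integral_Ioi_sub_one hg hg1 hτ
    have h2 : ContinuousWithinAt (fun s => ∫ t in Ioi (τ + s), (g t - 1)) (Ici 0) 0 := by
      refine ContinuousWithinAt.comp (g := fun τ => ∫ s in Ioi τ, (g s - 1)) (t := Ici τ)
        (by simpa using h1) (by fun_prop) (fun s hs => ?_)
      have : (0:ℝ) ≤ s := hs
      exact mem_Ici.2 (by linarith)
    exact (hasDerivAt_exp (𝕂 := 𝕜)).continuousAt.comp_continuousWithinAt h2
  · intro s hs
    have h1 : HasDerivAt (fun s => ∫ t in Ioi (τ + s), (g t - 1)) (-(g (τ + s) - 1)) s := by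
      have := hasDerivAt_integral_Ioi_sub_one hg hg1 (mem_Ioi.1 (hshift hs))
      exact this.comp_const_add τ s
    have h2 : HasDerivAt (fun s => expTail g (τ + s))
        (expTail g (τ + s) * -(g (τ + s) - 1)) s :=
      (hasDerivAt_exp (𝕂 := 𝕜)).comp_of_eq s h1 rfl
    have h3 : HasDerivAt (fun s : ℝ => Real.exp (-s)) (-Real.exp (-s)) s := by
      simpa using (hasDerivAt_neg s).exp
    refine HasDerivAt.congr_deriv (h3.smul h2).neg ?_
    simp only [RCLike.real_smul_eq_coe_mul]
    push_cast
    ring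
  · rw [← neg_zero]
    refine Tendsto.neg (squeeze_zero_norm' (a := fun s => Real.exp (-s) * (D + 1)) ?_ ?_)
    · filter_upwards [eventually_ge_atTop 0] with s hs
      rw [norm_smul, Real.norm_of_nonneg (Real.exp_pos _).le]
      gcongr
      exact hUb _ (by linarith)
    · simpa using (Real.tendsto_exp_neg_atTop_nhds_zero).mul_const (D + 1)

/-- The weight `w(τ) = e^{-τ} e^{2C e^{-τ}}`. -/
noncomputable def volterraWeight (C τ : ℝ) : ℝ := Real.exp (-τ) * Real.exp (2 * C * Real.exp (-τ))

/-- In the norm with the weight `w` the recursion with a kernel bounded by `1 + C e^{-τ}` is a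
contraction by the factor `1/2`. -/
lemma integral_volterraWeight (hC : 0 ≤ C) (τ : ℝ) :
    IntegrableOn (fun s => Real.exp (-s) * ((1 + C * Real.exp (-(τ + s)))
      * volterraWeight C (τ + s))) (Ioi 0) ∧
    ∫ s in Ioi 0, Real.exp (-s) * ((1 + C * Real.exp (-(τ + s))) * volterraWeight C (τ + s))
      = volterraWeight C τ / 2 := by
  have hd : ∀ s ∈ Ici (0 : ℝ), HasDerivAt
      (fun s => -(Real.exp (-s) * volterraWeight C (τ + s) / 2))
      (Real.exp (-s) * ((1 + C * Real.exp (-(τ + s))) * volterraWeight C (τ + s))) s := by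
    intro s _
    unfold volterraWeight
    have h1 : HasDerivAt (fun s : ℝ => Real.exp (-s)) (-Real.exp (-s)) s := by
      simpa using (hasDerivAt_neg s).exp
    have h2 : HasDerivAt (fun s : ℝ => Real.exp (-(τ + s))) (-Real.exp (-(τ + s))) s := by
      simpa using ((hasDerivAt_id s).const_add τ).neg.exp
    have h3 := (h2.const_mul (2 * C)).exp
    refine HasDerivAt.congr_deriv ((h1.mul (h2.mul h3)).div_const 2).neg ?_
    simp only [Pi.mul_apply]
    ring
  have hpos : ∀ s ∈ Ioi (0 : ℝ),
      0 ≤ Real.exp (-s) * ((1 + C * Real.exp (-(τ + s))) * volterraWeight C (τ + s)) := by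
    intro s _
    unfold volterraWeight
    positivity
  have hlim : Tendsto (fun s => -(Real.exp (-s) * volterraWeight C (τ + s) / 2)) atTop (𝓝 0) := by
    have h2 : Tendsto (fun s : ℝ => Real.exp (-(τ + s))) atTop (𝓝 0) :=
      Real.tendsto_exp_neg_atTop_nhds_zero.comp (tendsto_atTop_add_const_left _ τ tendsto_id)
    have h3 : Tendsto (fun s : ℝ => volterraWeight C (τ + s)) atTop
        (𝓝 (0 * Real.exp (2 * C * 0))) :=
      h2.mul ((Real.continuous_exp.tendsto _).comp (h2.const_mul (2 * C)))
    simpa using ((Real.tendsto_exp_neg_atTop_nhds_zero.mul h3).div_const 2).neg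
  refine ⟨integrableOn_Ioi_deriv_of_nonneg' hd hpos hlim, ?_⟩
  rw [integral_Ioi_of_hasDerivAt_of_nonneg' hd hpos hlim]
  simp

/-- The iterates of `u ↦ ∫₀^∞ e^{-s} g(τ + s) u(τ + s) ds`, started at the constant `1`, converge
to the fixed point `exp (∫_τ^∞ (g - 1))`. -/
theorem tendsto_exp_of_recursion {u : ℕ → ℝ → 𝕜} (hC : 0 ≤ C) (hg : ContinuousOn g (Ici 0))
    (hg1 : ∀ τ, 0 ≤ τ → ‖g τ - 1‖ ≤ C * Real.exp (-τ)) (hum : ∀ n, StronglyMeasurable (u n))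
    (h0 : ∀ τ, u 0 τ = 1)
    (hrec : ∀ n τ, 0 ≤ τ →
      u (n + 1) τ = ∫ s in Ioi 0, Real.exp (-s) • (g (τ + s) * u n (τ + s))) :
    Tendsto (fun n => u n 0) atTop (𝓝 (NormedSpace.exp (∫ s in Ioi 0, (g s - 1)))) := by
  obtain ⟨D, hD, hU⟩ := exists_norm_expTail_sub_one_le hC hg1
  have hw : ∀ τ, Real.exp (-τ) ≤ volterraWeight C τ := fun τ =>
    le_mul_of_one_le_right (Real.exp_pos _).le (Real.one_le_exp (by positivity))
  have hgb : ∀ t, 0 ≤ t → ‖g t‖ ≤ 1 + C * Real.exp (-t) := fun t ht => by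
    calc ‖g t‖ = ‖1 + (g t - 1)‖ := by simp
      _ ≤ _ := (norm_add_le _ _).trans (by rw [norm_one]; gcongr; exact hg1 t ht)
  have key : ∀ n τ, 0 ≤ τ → ‖u n τ - expTail g τ‖ ≤ D * (1 / 2) ^ n * volterraWeight C τ := by
    intro n
    induction n with
    | zero =>
      intro τ hτ
      rw [h0, norm_sub_rev, pow_zero, mul_one]
      exact (hU τ hτ).trans (by gcongr; exact hw τ)
    | succ n ih =>
      intro τ hτ
      obtain ⟨hi, he⟩ := integral_expTail hC hg hg1 hτ
      obtain ⟨hi2, he2⟩ := integral_volterraWeight hC τ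
      have hle : ∀ s ∈ Ioi (0 : ℝ),
          ‖Real.exp (-s) • (g (τ + s) * (u n (τ + s) - expTail g (τ + s)))‖
          ≤ D * (1 / 2) ^ n * (Real.exp (-s) * ((1 + C * Real.exp (-(τ + s)))
            * volterraWeight C (τ + s))) := by
        intro s hs
        have hs' : 0 ≤ τ + s := add_nonneg hτ (le_of_lt hs)
        rw [norm_smul, norm_mul, Real.norm_of_nonneg (Real.exp_pos _).le]
        calc _ ≤ Real.exp (-s) * ((1 + C * Real.exp (-(τ + s)))
              * (D * (1 / 2) ^ n * volterraWeight C (τ + s))) := by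
              gcongr
              · exact hgb _ hs'
              · exact ih _ hs'
          _ = _ := by ring
      have hshift : MapsTo (fun s => τ + s) (Ioi 0) (Ioi 0) := fun s hs => by
        have : (0:ℝ) < s := hs
        exact mem_Ioi.2 (by linarith)
      have hd : IntegrableOn
          (fun s => Real.exp (-s) • (g (τ + s) * (u n (τ + s) - expTail g (τ + s)))) (Ioi 0) := by
        refine Integrable.mono' (hi2.const_mul (D * (1 / 2) ^ n)) ?_
          ((ae_restrict_mem measurableSet_Ioi).mono hle)
        refine AEStronglyMeasurable.smul (by fun_prop) (AEStronglyMeasurable.mul ?_ ?_)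
        · exact ((hg.mono Ioi_subset_Ici_self).comp (by fun_prop) hshift).aestronglyMeasurable
            measurableSet_Ioi
        · refine AEStronglyMeasurable.sub ?_ ?_
          · exact ((hum n).comp_measurable (by fun_prop)).aestronglyMeasurable
          · exact ((continuousOn_expTail hg hg1).comp (by fun_prop) hshift).aestronglyMeasurable
              measurableSet_Ioi
      have e : u (n + 1) τ - expTail g τ
          = ∫ s in Ioi 0, Real.exp (-s) • (g (τ + s) * (u n (τ + s) - expTail g (τ + s))) := by
        rw [hrec n τ hτ, sub_eq_iff_eq_add]
        conv_rhs => rw [← he]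
        rw [← integral_add hd hi]
        refine integral_congr_ae (Eventually.of_forall fun s => ?_)
        simp only [← smul_add]
        ring_nf
      rw [e]
      refine (norm_integral_le_of_norm_le (hi2.const_mul (D * (1 / 2) ^ n))
        ((ae_restrict_mem measurableSet_Ioi).mono hle)).trans_eq ?_
      rw [integral_const_mul, he2]
      ring
  rw [tendsto_iff_norm_sub_tendsto_zero]
  refine squeeze_zero (fun _ => norm_nonneg _) (fun n => key n 0 le_rfl) ?_
  have := ((tendsto_pow_atTop_nhds_zero_of_lt_one (r := (1 / 2 : ℝ)) (by norm_num)
    (by norm_num)).const_mul D).mul_const (volterraWeight C 0)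
  simpa using this

end Volterra

/-! ### Exponential laws and the Lévy measure -/

section Laws

variable {E : Type*} [NormedAddCommGroup E] [NormedSpace ℝ E]

lemma map_val_lebPos : lebPos.map (Subtype.val : Rpos → ℝ) = volume.restrict (Ioi 0) := by
  have := (MeasurableEmbedding.subtype_coe (measurableSet_Ioi (a := (0 : ℝ)))).map_comap volume
  rwa [Subtype.range_coe] at this

lemma integrable_lebPos_withDensity_iff {ρ : ℝ → ℝ} (hρ : Measurable ρ) (h0 : ∀ r, 0 < r → 0 ≤ ρ r)
    (f : ℝ → E) :
    Integrable (fun r : Rpos => f r) (lebPos.withDensity fun r => ENNReal.ofReal (ρ r)) ↔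
      IntegrableOn (fun r => ρ r • f r) (Ioi 0) := by
  have h1 : (fun r : Rpos => ENNReal.ofReal (ρ r)) = fun r : Rpos => ((ρ r).toNNReal : ℝ≥0∞) := rfl
  rw [h1, integrable_withDensity_iff_integrable_smul (by fun_prop)]
  have h2 := MeasurableEmbedding.integrable_map_iff (μ := lebPos)
    (f := (Subtype.val : Rpos → ℝ))
    (MeasurableEmbedding.subtype_coe (measurableSet_Ioi (a := (0 : ℝ)))) (g := fun r => ρ r • f r)
  rw [map_val_lebPos] at h2
  rw [IntegrableOn, h2]
  refine integrable_congr (Eventually.of_forall fun r => ?_)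
  simp only [Function.comp]
  rw [NNReal.smul_def, Real.coe_toNNReal _ (h0 _ r.2)]

lemma integral_lebPos_withDensity {ρ : ℝ → ℝ} (hρ : Measurable ρ) (h0 : ∀ r, 0 < r → 0 ≤ ρ r)
    (f : ℝ → E) :
    ∫ r : Rpos, f r ∂(lebPos.withDensity fun r => ENNReal.ofReal (ρ r)) =
      ∫ r in Ioi 0, ρ r • f r := by
  rw [integral_withDensity_eq_integral_toReal_smul (by fun_prop) (by simp),
    ← integral_subtype_comap measurableSet_Ioi]
  refine integral_congr_ae (Eventually.of_forall fun r => ?_)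
  simp only
  rw [ENNReal.toReal_ofReal (h0 _ r.2)]

lemma integrable_expLaw_iff (f : ℝ → E) :
    Integrable (fun r : Rpos => f r) expLaw ↔
      IntegrableOn (fun r => Real.exp (-r) • f r) (Ioi 0) :=
  integrable_lebPos_withDensity_iff (ρ := fun r => Real.exp (-r)) (by fun_prop)
    (fun _ _ => (Real.exp_pos _).le) f

lemma integral_expLaw (f : ℝ → E) :
    ∫ r : Rpos, f r ∂expLaw = ∫ r in Ioi 0, Real.exp (-r) • f r :=
  integral_lebPos_withDensity (ρ := fun r => Real.exp (-r)) (by fun_prop)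
    (fun _ _ => (Real.exp_pos _).le) f

lemma integrable_exp_mul_expLaw {κ : ℝ} (hκ : κ < 1) :
    Integrable (fun r : Rpos => Real.exp (κ * r)) expLaw := by
  refine (integrable_expLaw_iff (fun r => Real.exp (κ * r))).2 ?_
  refine (integrableOn_exp_mul_Ioi (a := κ - 1) (by linarith) 0).congr_fun (fun r _ => ?_)
    measurableSet_Ioi
  simp only [smul_eq_mul, ← Real.exp_add]
  ring_nf

lemma integrable_mul_exp_mul_expLaw {κ : ℝ} (hκ : κ < 1) :
    Integrable (fun r : Rpos => r * Real.exp (κ * r)) expLaw := by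
  -- `r ≤ ε⁻¹ e^{ε r}` with `ε = (1 - κ) / 2` leaves an integrable exponential.
  have hε : 0 < (1 - κ) / 2 := by linarith
  refine Integrable.mono' ((integrable_exp_mul_expLaw (κ := (1 + κ) / 2) (by linarith)).const_mul
    ((1 - κ) / 2)⁻¹) (by fun_prop) (Eventually.of_forall fun r => ?_)
  have hr : (0 : ℝ) < r := r.2
  rw [Real.norm_of_nonneg (by positivity)]
  have h1 : (1 - κ) / 2 * r ≤ Real.exp ((1 - κ) / 2 * r) := by
    linarith [Real.add_one_le_exp ((1 - κ) / 2 * (r : ℝ))]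
  have h2 : Real.exp ((1 + κ) / 2 * r) = Real.exp ((1 - κ) / 2 * r) * Real.exp (κ * r) := by
    rw [← Real.exp_add]; ring_nf
  rw [h2, ← mul_assoc]
  gcongr
  rw [inv_mul_eq_div, le_div_iff₀ hε, mul_comm]
  exact h1

/-- The Lévy measure `r⁻¹ e^{-r} dr` of the gamma process. -/
noncomputable def levyPos : Measure Rpos :=
  lebPos.withDensity fun r => ENNReal.ofReal ((r : ℝ)⁻¹ * Real.exp (-(r : ℝ)))

instance : SigmaFinite lebPos :=
  SigmaFinite.of_map lebPos (f := (Subtype.val : Rpos → ℝ)) (by fun_prop)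
    (by rw [map_val_lebPos]; infer_instance)

instance : SigmaFinite levyPos :=
  SigmaFinite.withDensity_of_ne_top (by simp)

instance : SigmaFinite haarPos :=
  SigmaFinite.withDensity_of_ne_top (by simp)

lemma integrable_levyPos_iff (f : ℝ → E) :
    Integrable (fun r : Rpos => f r) levyPos ↔
      IntegrableOn (fun r => (r⁻¹ * Real.exp (-r)) • f r) (Ioi 0) :=
  integrable_lebPos_withDensity_iff (ρ := fun r => r⁻¹ * Real.exp (-r)) (by fun_prop)
    (fun r hr => by positivity) f

lemma integrable_mul_exp_mul_levyPos {κ : ℝ} (hκ : κ < 1) :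
    Integrable (fun r : Rpos => r * Real.exp (κ * r)) levyPos := by
  refine (integrable_levyPos_iff (fun r => r * Real.exp (κ * r))).2 ?_
  refine (integrableOn_exp_mul_Ioi (a := κ - 1) (by linarith) 0).congr_fun (fun r hr => ?_)
    measurableSet_Ioi
  have hr' : (r : ℝ) ≠ 0 := (mem_Ioi.1 hr).ne'
  have h2 : Real.exp ((κ - 1) * r) = Real.exp (-r) * Real.exp (κ * r) := by
    rw [← Real.exp_add]; ring_nf
  simp only [smul_eq_mul, h2]
  field_simp

/-- The number `e^{-τ}` as an element of `ℝ*₊`. -/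
noncomputable def expNeg (τ : ℝ) : Rpos := ⟨Real.exp (-τ), Real.exp_pos _⟩

lemma expNeg_add (s t : ℝ) : expNeg (s + t) = expNeg s * expNeg t := by
  apply Subtype.ext
  change Real.exp (-(s + t)) = Real.exp (-s) * Real.exp (-t)
  rw [← Real.exp_add]; ring_nf

lemma expNeg_zero : expNeg 0 = 1 := Subtype.ext (by simp [expNeg])

@[fun_prop]
lemma continuous_expNeg : Continuous expNeg := by
  unfold expNeg; fun_prop

lemma coe_expNeg_mul (τ : ℝ) (r : Rpos) : ((expNeg τ * r : Rpos) : ℝ) = Real.exp (-τ) * r := rfl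

lemma continuous_mul_Rpos : Continuous fun q : Rpos × Rpos => q.1 * q.2 :=
  continuous_induced_rng.2 (by
    change Continuous fun q : Rpos × Rpos => (q.1 : ℝ) * q.2
    fun_prop)

/-- The inner integral in the computation of the image of `dτ × e^{-v} dv` under
`(τ, v) ↦ e^{-τ} v`, after the substitution `v = e^τ r`. -/
lemma lintegral_exp_mul_exp_neg_exp_mul {r : ℝ} (hr : 0 < r) :
    ∫⁻ τ in Ioi 0, ENNReal.ofReal (Real.exp τ * Real.exp (-(Real.exp τ * r)))
      = ENNReal.ofReal (r⁻¹ * Real.exp (-r)) := by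
  have hd : ∀ s ∈ Ici (0 : ℝ), HasDerivAt (fun τ => -(r⁻¹ * Real.exp (-(Real.exp τ * r))))
      (Real.exp s * Real.exp (-(Real.exp s * r))) s := by
    intro s _
    refine HasDerivAt.congr_deriv (((((Real.hasDerivAt_exp s).mul_const r).neg).exp).const_mul
      r⁻¹).neg ?_
    simp only [Pi.neg_apply]
    field_simp
  have hpos : ∀ s ∈ Ioi (0 : ℝ), 0 ≤ Real.exp s * Real.exp (-(Real.exp s * r)) := by
    intro s _; positivity
  have hlim : Tendsto (fun τ => -(r⁻¹ * Real.exp (-(Real.exp τ * r)))) atTop (𝓝 0) := by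
    have := (Real.tendsto_exp_neg_atTop_nhds_zero.comp
      (Real.tendsto_exp_atTop.atTop_mul_const hr)).const_mul r⁻¹
    simpa using this.neg
  rw [← ofReal_integral_eq_lintegral_ofReal (integrableOn_Ioi_deriv_of_nonneg' hd hpos hlim)
    (Eventually.of_forall fun s => by positivity),
    integral_Ioi_of_hasDerivAt_of_nonneg' hd hpos hlim]
  simp

lemma expLaw_preimage_expNeg_mul {B : Set ℝ} (hB : MeasurableSet B) (τ : ℝ) :
    expLaw {v : Rpos | ((expNeg τ * v : Rpos) : ℝ) ∈ B} =
      ∫⁻ r in Ioi 0, B.indicator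
        (fun r => ENNReal.ofReal (Real.exp τ * Real.exp (-(Real.exp τ * r)))) r := by
  have hm : MeasurableSet {v : ℝ | Real.exp (-τ) * v ∈ B} :=
    (by fun_prop : Measurable fun v : ℝ => Real.exp (-τ) * v) hB
  have hm' : MeasurableSet {v : Rpos | ((expNeg τ * v : Rpos) : ℝ) ∈ B} :=
    measurable_subtype_coe hm
  have h1 : expLaw {v : Rpos | ((expNeg τ * v : Rpos) : ℝ) ∈ B}
      = ∫⁻ v in Ioi 0, {v : ℝ | Real.exp (-τ) * v ∈ B}.indicator
        (fun v => ENNReal.ofReal (Real.exp (-v))) v := by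
    rw [expLaw, withDensity_apply _ hm', ← lintegral_indicator hm']
    exact lintegral_subtype_comap (s := Ioi (0 : ℝ)) measurableSet_Ioi
      ({v : ℝ | Real.exp (-τ) * v ∈ B}.indicator (fun v => ENNReal.ofReal (Real.exp (-v))))
  have hmap := Real.smul_map_volume_mul_left (Real.exp_pos (-τ)).ne'
  rw [h1, ← lintegral_indicator measurableSet_Ioi, ← lintegral_indicator measurableSet_Ioi]
  conv_rhs => rw [← hmap]
  rw [lintegral_smul_measure, lintegral_map, abs_of_pos (Real.exp_pos _), smul_eq_mul,
    ← lintegral_const_mul]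
  · refine lintegral_congr fun v => ?_
    have e0 : (0 < Real.exp (-τ) * v) ↔ 0 < v := mul_pos_iff_of_pos_left (Real.exp_pos _)
    by_cases hv : 0 < v
    · rw [indicator_of_mem (mem_Ioi.2 hv), indicator_of_mem (mem_Ioi.2 (e0.2 hv))]
      by_cases hb : Real.exp (-τ) * v ∈ B
      · rw [indicator_of_mem (by exact hb), indicator_of_mem hb, ← ENNReal.ofReal_mul
          (Real.exp_pos _).le]
        congr 1
        have e1 : Real.exp (-τ) * Real.exp τ = 1 := by rw [← Real.exp_add]; simp
        have e2 : Real.exp τ * (Real.exp (-τ) * v) = v := by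
          rw [← mul_assoc, mul_comm (Real.exp τ), e1, one_mul]
        rw [e2, ← mul_assoc, e1, one_mul]
      · rw [indicator_of_notMem (by exact hb), indicator_of_notMem hb, mul_zero]
    · rw [indicator_of_notMem (by simpa using hv), indicator_of_notMem (by
        rw [mem_Ioi, e0]; exact hv), mul_zero]
  · refine Measurable.indicator ?_ measurableSet_Ioi |>.comp (by fun_prop)
    exact Measurable.indicator (by fun_prop) hB
  · exact Measurable.indicator (Measurable.indicator (by fun_prop) hB) measurableSet_Ioi
  · fun_prop

/-- The map `(τ, v) ↦ e^{-τ} v` takes `dτ × e^{-v} dv` on `ℝ*₊ × ℝ*₊` to `r⁻¹ e^{-r} dr`. -/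
lemma measurePreserving_expNeg_mul :
    MeasurePreserving (fun q : ℝ × Rpos => expNeg q.1 * q.2)
      ((volume.restrict (Ioi 0)).prod expLaw) levyPos := by
  have hmeas : Measurable (fun q : ℝ × Rpos => expNeg q.1 * q.2) :=
    (continuous_mul_Rpos.comp (by fun_prop : Continuous fun q : ℝ × Rpos =>
      (expNeg q.1, q.2))).measurable
  refine ⟨hmeas, Measure.ext fun s hs => ?_⟩
  obtain ⟨B, hB, rfl⟩ := hs
  rw [Measure.map_apply hmeas (measurable_subtype_coe hB), Measure.prod_apply
    (hmeas (measurable_subtype_coe hB))]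
  have h1 : ∀ τ : ℝ, expLaw (Prod.mk τ ⁻¹' ((fun q : ℝ × Rpos => expNeg q.1 * q.2) ⁻¹'
      (Subtype.val ⁻¹' B))) = ∫⁻ r in Ioi 0, B.indicator
        (fun r => ENNReal.ofReal (Real.exp τ * Real.exp (-(Real.exp τ * r)))) r :=
    fun τ => expLaw_preimage_expNeg_mul hB τ
  simp_rw [h1]
  rw [lintegral_lintegral_swap]
  · rw [levyPos, withDensity_apply _ (measurable_subtype_coe hB),
      ← lintegral_indicator (measurable_subtype_coe hB)]
    refine Eq.trans ?_ (lintegral_subtype_comap (s := Ioi (0 : ℝ)) measurableSet_Ioi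
      (B.indicator (fun v => ENNReal.ofReal (v⁻¹ * Real.exp (-v))))).symm
    refine setLIntegral_congr_fun measurableSet_Ioi fun r hr => ?_
    by_cases hb : r ∈ B
    · simp only [indicator_of_mem hb]
      exact lintegral_exp_mul_exp_neg_exp_mul hr
    · simp [indicator_of_notMem hb]
  · refine Measurable.aemeasurable ?_
    have : (Function.uncurry fun (x y : ℝ) => B.indicator
        (fun r => ENNReal.ofReal (Real.exp x * Real.exp (-(Real.exp x * r)))) y)
        = (Prod.snd ⁻¹' B).indicator (fun q : ℝ × ℝ =>
          ENNReal.ofReal (Real.exp q.1 * Real.exp (-(Real.exp q.1 * q.2)))) := by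
      ext ⟨x, y⟩
      by_cases hy : y ∈ B <;> simp [Function.uncurry, indicator, hy]
    rw [this]
    exact Measurable.indicator (by fun_prop) (measurable_snd hB)

end Laws

/-! ### The recursion for the gamma process -/

section GammaProcess

variable {𝕜 : Type*} [RCLike 𝕜] {X : Type*}

lemma gammaPoints_fst_le (η : ℕ → (Rpos × Rpos) × X) (k : ℕ) :
    ((gammaPoints η k).1 : ℝ) ≤ (η k).1.2 := by
  change Real.exp _ * ((η k).1.2 : ℝ) ≤ _
  refine mul_le_of_le_one_left (η k).1.2.2.le (Real.exp_le_one_iff.2 ?_)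
  exact neg_nonpos.2 (Finset.sum_nonneg fun j _ => (η j).1.1.2.le)

lemma gammaPoints_natCons_zero (a : (Rpos × Rpos) × X) (η : ℕ → (Rpos × Rpos) × X) :
    gammaPoints (natCons a η) 0
      = (expNeg a.1.1 * a.1.2, a.2) := by
  refine Prod.ext (Subtype.ext ?_) rfl
  change Real.exp _ * _ = Real.exp _ * _
  simp [natCons]

lemma gammaPoints_natCons_succ (a : (Rpos × Rpos) × X) (η : ℕ → (Rpos × Rpos) × X) (k : ℕ) :
    gammaPoints (natCons a η) (k + 1)
      = (expNeg a.1.1 * (gammaPoints η k).1, (gammaPoints η k).2) := by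
  refine Prod.ext (Subtype.ext ?_) rfl
  change Real.exp _ * _ = Real.exp _ * (Real.exp _ * _)
  rw [Finset.sum_range_succ', ← mul_assoc, ← Real.exp_add]
  simp only [natCons]
  congr 2
  ring

variable [MeasurableSpace X]

/-- Functions `F(r, x)`, continuous in `r` and measurable in `x`, whose multiplicative functional
`∏ₖ F(rₖ, xₖ)` is integrable for the gamma process: `|F(r, x)| ≤ e^{κ r}` with `κ < 1` controls
large weights, and `|F(r, x) - 1| ≤ C r e^{κ r}` controls small ones. -/
structure IsGammaMultiplier (F : Rpos → X → 𝕜) (κ C : ℝ) : Prop where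
  nonneg : 0 ≤ κ
  lt_one : κ < 1
  const_nonneg : 0 ≤ C
  cont : ∀ x, Continuous fun r => F r x
  meas : ∀ r, StronglyMeasurable (F r)
  norm_le : ∀ r x, ‖F r x‖ ≤ Real.exp (κ * r)
  norm_sub_one_le : ∀ r x, ‖F r x - 1‖ ≤ C * (r * Real.exp (κ * r))

/-- The law of the independent variables from which `gammaPoints` is built. -/
noncomputable def gammaNoise (m : Measure X) : Measure (ℕ → (Rpos × Rpos) × X) :=
  Measure.infinitePi fun _ : ℕ => (expLaw.prod expLaw).prod m

instance (m : Measure X) [IsProbabilityMeasure m] : IsProbabilityMeasure (gammaNoise m) := by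
  unfold gammaNoise; infer_instance

/-- The mean of `F(e^{-τ} V, x)` for an exponential variable `V` and a point `x` with law `m`. -/
noncomputable def pointMean (m : Measure X) (F : Rpos → X → 𝕜) (τ : ℝ) : 𝕜 :=
  ∫ q : Rpos × X, F (expNeg τ * q.1) q.2 ∂(expLaw.prod m)

/-- The mean of `∏_{k < n} F(e^{-τ} rₖ, xₖ)` for the points `(rₖ, xₖ)` of `gammaPoints`. -/
noncomputable def prodMean (m : Measure X) (F : Rpos → X → 𝕜) (n : ℕ) (τ : ℝ) : 𝕜 :=
  ∫ η, ∏ k ∈ Finset.range n, F (expNeg τ * (gammaPoints η k).1) (gammaPoints η k).2 ∂(gammaNoise m)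

lemma measurable_mk_Rpos {A : Type*} [MeasurableSpace A] {f : A → Rpos}
    (hf : Measurable fun a => (f a : ℝ)) : Measurable f :=
  (MeasurableEmbedding.subtype_coe measurableSet_Ioi).measurable_comp_iff.1 hf

lemma measurable_gammaPoints :
    Measurable (gammaPoints : (ℕ → (Rpos × Rpos) × X) → ℕ → Rpos × X) := by
  refine measurable_pi_lambda _ fun k => Measurable.prodMk (measurable_mk_Rpos ?_) (by fun_prop)
  change Measurable fun η : ℕ → (Rpos × Rpos) × X =>
    Real.exp (-∑ j ∈ Finset.range (k + 1), ((η j).1.1 : ℝ)) * ((η k).1.2 : ℝ)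
  fun_prop

lemma measurable_expNeg_mul : Measurable fun q : ℝ × Rpos => expNeg q.1 * q.2 :=
  (continuous_mul_Rpos.comp (by fun_prop : Continuous fun q : ℝ × Rpos =>
      (expNeg q.1, q.2))).measurable

namespace IsGammaMultiplier

variable {m : Measure X} [IsProbabilityMeasure m] {F : Rpos → X → 𝕜} {κ C : ℝ}

lemma stronglyMeasurable (hF : IsGammaMultiplier F κ C) :
    StronglyMeasurable fun q : Rpos × X => F q.1 q.2 :=
  stronglyMeasurable_uncurry_of_continuous_of_stronglyMeasurable hF.cont hF.meas

lemma stronglyMeasurable_comp (hF : IsGammaMultiplier F κ C) {A : Type*} [MeasurableSpace A]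
    {t : A → ℝ} {r : A → Rpos} {x : A → X} (ht : Measurable t) (hr : Measurable r)
    (hx : Measurable x) : StronglyMeasurable fun a => F (expNeg (t a) * r a) (x a) :=
  hF.stronglyMeasurable.comp_measurable
    ((measurable_expNeg_mul.comp (ht.prodMk hr)).prodMk hx)

lemma norm_expNeg_mul_le (hF : IsGammaMultiplier F κ C) {τ : ℝ} (hτ : 0 ≤ τ) {r : Rpos} {s : ℝ}
    (hr : (r : ℝ) ≤ s) (x : X) : ‖F (expNeg τ * r) x‖ ≤ Real.exp (κ * s) := by
  refine (hF.norm_le _ _).trans (Real.exp_le_exp.2 (mul_le_mul_of_nonneg_left ?_ hF.nonneg))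
  rw [coe_expNeg_mul]
  exact (mul_le_of_le_one_left r.2.le (Real.exp_le_one_iff.2 (by linarith))).trans hr

lemma integrable_point (hF : IsGammaMultiplier F κ C) {τ : ℝ} (hτ : 0 ≤ τ) :
    Integrable (fun q : Rpos × X => F (expNeg τ * q.1) q.2) (expLaw.prod m) :=
  Integrable.mono' ((integrable_exp_mul_expLaw hF.lt_one).comp_fst m)
    (hF.stronglyMeasurable_comp measurable_const measurable_fst measurable_snd).aestronglyMeasurable
    (Eventually.of_forall fun q => hF.norm_expNeg_mul_le hτ le_rfl q.2)

lemma continuousOn_pointMean (hF : IsGammaMultiplier F κ C) :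
    ContinuousOn (pointMean m F) (Ici 0) := by
  refine continuousOn_of_dominated (bound := fun q : Rpos × X => Real.exp (κ * q.1))
    (fun τ hτ => (hF.integrable_point hτ).1)
    (fun τ hτ => Eventually.of_forall fun q => hF.norm_expNeg_mul_le hτ le_rfl q.2)
    ((integrable_exp_mul_expLaw hF.lt_one).comp_fst m)
    (Eventually.of_forall fun q => Continuous.continuousOn ?_)
  exact (hF.cont q.2).comp (continuous_mul_Rpos.comp (by fun_prop : Continuous fun t : ℝ =>
      (expNeg t, q.1)))

lemma norm_pointMean_sub_one_le (hF : IsGammaMultiplier F κ C) {τ : ℝ} (hτ : 0 ≤ τ) :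
    ‖pointMean m F τ - 1‖
      ≤ C * (∫ r : Rpos, r * Real.exp (κ * r) ∂expLaw) * Real.exp (-τ) := by
  have e : pointMean m F τ - 1
      = ∫ q : Rpos × X, (F (expNeg τ * q.1) q.2 - 1) ∂(expLaw.prod m) := by
    rw [integral_sub (hF.integrable_point hτ) (integrable_const _), pointMean]
    simp
  have hi := ((integrable_mul_exp_mul_expLaw hF.lt_one).comp_fst m)
  rw [e]
  refine (norm_integral_le_of_norm_le (hi.const_mul (C * Real.exp (-τ)))
    (Eventually.of_forall fun q => ?_)).trans_eq ?_
  · refine (hF.norm_sub_one_le _ _).trans ?_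
    have hr : (0 : ℝ) < q.1 := q.1.2
    have hle : Real.exp (-τ) * (q.1 : ℝ) ≤ q.1 :=
      mul_le_of_le_one_left hr.le (Real.exp_le_one_iff.2 (by linarith))
    rw [coe_expNeg_mul, mul_assoc C, mul_assoc (Real.exp (-τ))]
    have := hF.const_nonneg
    have := hF.nonneg
    gcongr
  · rw [integral_const_mul, integral_fun_fst (f := fun r : Rpos => (r : ℝ) * Real.exp (κ * r))]
    simp
    ring

lemma stronglyMeasurable_prod (hF : IsGammaMultiplier F κ C) (n : ℕ) :
    StronglyMeasurable fun q : ℝ × (ℕ → (Rpos × Rpos) × X) => ∏ k ∈ Finset.range n,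
      F (expNeg q.1 * (gammaPoints q.2 k).1) (gammaPoints q.2 k).2 := by
  refine Finset.stronglyMeasurable_fun_prod _ fun k _ => ?_
  have h1 : Measurable fun q : ℝ × (ℕ → (Rpos × Rpos) × X) => gammaPoints q.2 k :=
    (measurable_pi_apply k).comp (measurable_gammaPoints.comp measurable_snd)
  exact hF.stronglyMeasurable_comp measurable_fst h1.fst h1.snd

lemma stronglyMeasurable_prodMean (hF : IsGammaMultiplier F κ C) (n : ℕ) :
    StronglyMeasurable (prodMean m F n) :=
  StronglyMeasurable.integral_prod_right
    (f := fun (τ : ℝ) η => ∏ k ∈ Finset.range n,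
      F (expNeg τ * (gammaPoints η k).1) (gammaPoints η k).2) (hF.stronglyMeasurable_prod n)

lemma norm_prod_le (hF : IsGammaMultiplier F κ C) {τ : ℝ} (hτ : 0 ≤ τ) (n : ℕ)
    (η : ℕ → (Rpos × Rpos) × X) :
    ‖∏ k ∈ Finset.range n, F (expNeg τ * (gammaPoints η k).1) (gammaPoints η k).2‖
      ≤ ∏ k ∈ Finset.range n, Real.exp (κ * (η k).1.2) := by
  rw [norm_prod]
  exact Finset.prod_le_prod (fun _ _ => norm_nonneg _) fun k _ =>
    hF.norm_expNeg_mul_le hτ (gammaPoints_fst_le η k) _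

end IsGammaMultiplier

lemma integrable_prod_infinitePi {A : Type*} [MeasurableSpace A] {μ : Measure A}
    [IsProbabilityMeasure μ] {G : A → ℝ} (hG : Integrable G μ) (hGm : Measurable G) (n : ℕ) :
    Integrable (fun η : ℕ → A => ∏ k ∈ Finset.range n, G (η k))
      (Measure.infinitePi fun _ : ℕ => μ) := by
  induction n with
  | zero => simp
  | succ n ih =>
    have hp := measurePreserving_natCons μ
    have hm : Measurable fun η : ℕ → A => ∏ k ∈ Finset.range (n + 1), G (η k) :=
      Finset.measurable_fun_prod _ fun k _ => hGm.comp (measurable_pi_apply k)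
    rw [← hp.map_eq, integrable_map_measure hm.aestronglyMeasurable hp.measurable.aemeasurable]
    refine (hG.mul_prod ih).congr (Eventually.of_forall fun p => ?_)
    simp only [Function.comp]
    rw [Finset.prod_range_succ', mul_comm]
    rfl

variable {m : Measure X} [IsProbabilityMeasure m] {F : Rpos → X → 𝕜} {κ C : ℝ}

/-- The partial products are dominated by `∏ e^{κ V_k}`, because `r_k ≤ V_k`. -/
lemma integrable_exp_noise (hκ : κ < 1) (n : ℕ) : Integrable
    (fun η : ℕ → (Rpos × Rpos) × X => ∏ k ∈ Finset.range n, Real.exp (κ * (η k).1.2))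
    (gammaNoise m) :=
  integrable_prod_infinitePi (G := fun a : (Rpos × Rpos) × X => Real.exp (κ * a.1.2))
    (((integrable_exp_mul_expLaw hκ).comp_snd expLaw).comp_fst m) (by fun_prop) n

/-- Conditioning on the first point: the remaining points are `e^{-E₀}` times an independent copy of
the whole sequence. -/
lemma IsGammaMultiplier.prodMean_succ (hF : IsGammaMultiplier F κ C) (n : ℕ) {τ : ℝ} (hτ : 0 ≤ τ) :
    prodMean m F (n + 1) τ
      = ∫ s in Ioi 0, Real.exp (-s) • (pointMean m F (τ + s) * prodMean m F n (τ + s)) := by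
  have hp := measurePreserving_natCons ((expLaw.prod expLaw).prod m)
  have hm1 : StronglyMeasurable fun η => ∏ k ∈ Finset.range (n + 1),
      F (expNeg τ * (gammaPoints η k).1) (gammaPoints η k).2 :=
    (hF.stronglyMeasurable_prod (n + 1)).comp_measurable (measurable_const.prodMk measurable_id)
  have e1 : ∀ p : ((Rpos × Rpos) × X) × (ℕ → (Rpos × Rpos) × X),
      ∏ k ∈ Finset.range (n + 1),
        F (expNeg τ * (gammaPoints (natCons p.1 p.2) k).1)
          (gammaPoints (natCons p.1 p.2) k).2
      = F (expNeg (τ + p.1.1.1) * p.1.1.2) p.1.2 * ∏ k ∈ Finset.range n,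
          F (expNeg (τ + p.1.1.1) * (gammaPoints p.2 k).1) (gammaPoints p.2 k).2 := by
    intro p
    rw [Finset.prod_range_succ', gammaPoints_natCons_zero, mul_comm, expNeg_add, mul_assoc]
    simp only [gammaPoints_natCons_succ, mul_assoc]
  have hnn : ∀ r : Rpos, 0 ≤ τ + r := fun r => add_nonneg hτ r.2.le
  have hint : Integrable (fun p : ((Rpos × Rpos) × X) × (ℕ → (Rpos × Rpos) × X) =>
      F (expNeg (τ + p.1.1.1) * p.1.1.2) p.1.2 * ∏ k ∈ Finset.range n,
          F (expNeg (τ + p.1.1.1) * (gammaPoints p.2 k).1) (gammaPoints p.2 k).2)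
      (((expLaw.prod expLaw).prod m).prod (gammaNoise m)) := by
    refine Integrable.mono' ((((integrable_exp_mul_expLaw hF.lt_one).comp_snd expLaw).comp_fst
      m).mul_prod (integrable_exp_noise hF.lt_one n)) ?_ (Eventually.of_forall fun p => ?_)
    · refine StronglyMeasurable.aestronglyMeasurable (StronglyMeasurable.mul ?_ ?_)
      · exact hF.stronglyMeasurable_comp (by fun_prop) (by fun_prop) (by fun_prop)
      · exact (hF.stronglyMeasurable_prod n).comp_measurable
          (g := fun p : ((Rpos × Rpos) × X) × (ℕ → (Rpos × Rpos) × X) =>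
            (τ + (p.1.1.1 : ℝ), p.2)) (by fun_prop)
    · rw [norm_mul]
      exact mul_le_mul (hF.norm_expNeg_mul_le (hnn _) le_rfl _) (hF.norm_prod_le (hnn _) n _)
        (norm_nonneg _) (Real.exp_pos _).le
  have e2 : prodMean m F (n + 1) τ = ∫ a, F (expNeg (τ + a.1.1) * a.1.2) a.2
      * prodMean m F n (τ + a.1.1) ∂((expLaw.prod expLaw).prod m) := by
    rw [prodMean, gammaNoise, ← hp.map_eq, integral_map hp.measurable.aemeasurable
      hm1.aestronglyMeasurable]
    simp_rw [e1]
    rw [← gammaNoise, integral_prod _ hint]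
    simp_rw [integral_const_mul]
    rfl
  have hint2 : Integrable (fun a : (Rpos × Rpos) × X => F (expNeg (τ + a.1.1) * a.1.2) a.2
      * prodMean m F n (τ + a.1.1)) ((expLaw.prod expLaw).prod m) := by
    refine hint.integral_prod_left.congr (Eventually.of_forall fun a => ?_)
    simp_rw [integral_const_mul]
    rfl
  have ha := measurePreserving_prodAssoc expLaw expLaw m
  have hint3 : Integrable (fun b : Rpos × (Rpos × X) => F (expNeg (τ + b.1) * b.2.1) b.2.2
      * prodMean m F n (τ + b.1)) (expLaw.prod (expLaw.prod m)) :=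
    (ha.integrable_comp_emb MeasurableEquiv.prodAssoc.measurableEmbedding).1 hint2
  rw [e2, ← integral_expLaw (fun s => pointMean m F (τ + s) * prodMean m F n (τ + s))]
  refine (ha.integral_comp MeasurableEquiv.prodAssoc.measurableEmbedding
    (fun b : Rpos × (Rpos × X) => F (expNeg (τ + b.1) * b.2.1) b.2.2
      * prodMean m F n (τ + b.1))).trans ?_
  rw [integral_prod _ hint3]
  simp_rw [integral_mul_const]
  rfl

/-- The limit of the means of the partial products: a Campbell formula for the gamma process. -/
theorem IsGammaMultiplier.tendsto_prodMean (hF : IsGammaMultiplier F κ C) :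
    Tendsto (fun n => prodMean m F n 0) atTop
      (𝓝 (NormedSpace.exp (∫ s in Ioi 0, (pointMean m F s - 1)))) := by
  refine tendsto_exp_of_recursion (C := C * (∫ r : Rpos, r * Real.exp (κ * r) ∂expLaw))
    (mul_nonneg hF.const_nonneg (integral_nonneg fun r => ?_)) hF.continuousOn_pointMean
    (fun τ hτ => hF.norm_pointMean_sub_one_le hτ) hF.stronglyMeasurable_prodMean
    (fun τ => by simp [prodMean]) (fun n τ hτ => hF.prodMean_succ n hτ)
  have : (0 : ℝ) < r := r.2
  positivity

lemma IsGammaMultiplier.integrable_levy (hF : IsGammaMultiplier F κ C) :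
    Integrable (fun q : Rpos × X => F q.1 q.2 - 1) (levyPos.prod m) :=
  Integrable.mono' (((integrable_mul_exp_mul_levyPos hF.lt_one).const_mul C).comp_fst m)
    (hF.stronglyMeasurable.sub stronglyMeasurable_const).aestronglyMeasurable
    (Eventually.of_forall fun q => hF.norm_sub_one_le q.1 q.2)

/-- The exponent in terms of the Lévy measure, by the change of variables `r = e^{-τ} v`. -/
lemma IsGammaMultiplier.integral_pointMean_sub_one (hF : IsGammaMultiplier F κ C) :
    ∫ s in Ioi 0, (pointMean m F s - 1) = ∫ q, (F q.1 q.2 - 1) ∂(levyPos.prod m) := by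
  have ha := (measurePreserving_prodAssoc (volume.restrict (Ioi (0 : ℝ))) expLaw m).symm
  have hp := (measurePreserving_expNeg_mul.prod (MeasurePreserving.id m)).comp ha
  have hi : Integrable (fun b : ℝ × (Rpos × X) => F (expNeg b.1 * b.2.1) b.2.2 - 1)
      ((volume.restrict (Ioi (0 : ℝ))).prod (expLaw.prod m)) :=
    hp.integrable_comp_of_integrable (hF.integrable_levy (m := m))
  have e : ∫ q, (F q.1 q.2 - 1) ∂(levyPos.prod m) = ∫ b : ℝ × (Rpos × X),
      (F (expNeg b.1 * b.2.1) b.2.2 - 1)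
        ∂((volume.restrict (Ioi (0 : ℝ))).prod (expLaw.prod m)) := by
    rw [← hp.map_eq, integral_map hp.measurable.aemeasurable
      (by rw [hp.map_eq]; exact (hF.integrable_levy (m := m)).1)]
    rfl
  rw [e, integral_prod _ hi]
  refine setIntegral_congr_fun measurableSet_Ioi fun s hs => ?_
  simp only
  rw [integral_sub (hF.integrable_point (le_of_lt hs)) (integrable_const _), pointMean]
  simp

end GammaProcess

/-! ### Multiplicative functionals of the gamma process -/

section Configurations

variable {𝕜 : Type*} [RCLike 𝕜] {X : Type*}

/-- `e^{κ ∑ₖ rₖ}` as a function of a sequence of points; the value is `∞` if the series diverges. -/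
noncomputable def expTotal (κ : ℝ) (ζ : ℕ → Rpos × X) : ℝ≥0∞ :=
  ⨆ n, ENNReal.ofReal (∏ k ∈ Finset.range n, Real.exp (κ * (ζ k).1))

lemma Config.expTotal_eq {κ : ℝ} (h0 : 0 ≤ κ) (ω : Config X) :
    expTotal κ ω.1 = ENNReal.ofReal (Real.exp (κ * ∑' k, (ω.r k : ℝ))) := by
  refine iSup_eq_of_tendsto ?_ ?_
  · refine monotone_nat_of_le_succ fun n => ENNReal.ofReal_le_ofReal ?_
    rw [Finset.prod_range_succ]
    exact le_mul_of_one_le_right (Finset.prod_nonneg fun _ _ => (Real.exp_pos _).le)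
      (Real.one_le_exp (mul_nonneg h0 (ω.1 n).1.2.le))
  · refine ENNReal.tendsto_ofReal ?_
    simp_rw [← Real.exp_sum, ← Finset.mul_sum]
    exact (Real.continuous_exp.tendsto _).comp ((ω.2.hasSum.tendsto_sum_nat).const_mul κ)

variable [MeasurableSpace X]

lemma measurableSet_summable_weights :
    MeasurableSet {ω : ℕ → Rpos × X | Summable fun k => ((ω k).1 : ℝ)} := by
  have e : {ω : ℕ → Rpos × X | Summable fun k => ((ω k).1 : ℝ)}
      = {ω | ∑' k, ENNReal.ofReal (ω k).1 ≠ ⊤} := by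
    ext ω
    change _ ↔ ∑' k, ((((ω k).1 : ℝ).toNNReal : NNReal) : ℝ≥0∞) ≠ ⊤
    rw [mem_ofPred_eq, ENNReal.tsum_coe_ne_top_iff_summable, ← NNReal.summable_coe]
    simp only [Real.coe_toNNReal _ (ω _).1.2.le]
  rw [e]
  exact (measurableSet_eq_fun (Measurable.tsum fun k => by fun_prop)
    measurable_const).compl

lemma measurableEmbedding_config :
    MeasurableEmbedding (Subtype.val : Config X → ℕ → Rpos × X) :=
  MeasurableEmbedding.subtype_coe measurableSet_summable_weights

@[fun_prop]
lemma measurable_config_r (k : ℕ) : Measurable fun ω : Config X => ω.r k :=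
  ((measurable_pi_apply k).comp measurable_subtype_coe).fst

@[fun_prop]
lemma measurable_config_x (k : ℕ) : Measurable fun ω : Config X => ω.x k :=
  ((measurable_pi_apply k).comp measurable_subtype_coe).snd

/-- `F(r, x) = e^{κ r}`, the multiplier that dominates all the others. -/
lemma isGammaMultiplier_exp {κ : ℝ} (h0 : 0 ≤ κ) (h1 : κ < 1) :
    IsGammaMultiplier (fun (r : Rpos) (_ : X) => Real.exp (κ * r)) κ κ where
  nonneg := h0
  lt_one := h1
  const_nonneg := h0
  cont _ := by fun_prop
  meas _ := stronglyMeasurable_const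
  norm_le r _ := by rw [Real.norm_of_nonneg (Real.exp_pos _).le]
  norm_sub_one_le r _ := by
    have hr : (0 : ℝ) < r := r.2
    rw [Real.norm_of_nonneg (sub_nonneg.2 (Real.one_le_exp (by positivity)))]
    have h2 := Real.add_one_le_exp (-(κ * r))
    have h3 : Real.exp (κ * r) * Real.exp (-(κ * r)) = 1 := by rw [← Real.exp_add]; simp
    nlinarith [Real.exp_pos (κ * r)]

variable {m : Measure X} [IsProbabilityMeasure m] {F : Rpos → X → 𝕜} {κ C : ℝ}

lemma measurable_expTotal (κ : ℝ) : Measurable (expTotal κ : (ℕ → Rpos × X) → ℝ≥0∞) := by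
  refine Measurable.iSup fun n => ENNReal.measurable_ofReal.comp
    (Finset.measurable_fun_prod _ fun k _ => ?_)
  fun_prop

/-- The partial products of the multiplier `e^{κ r}` have bounded means, so by monotone convergence
`e^{κ ∑ r_k}` is integrable. This gives both the summability of the weights and the dominating
function for all other multipliers. -/
lemma lintegral_expTotal_gammaPoints_lt_top (h0 : 0 ≤ κ) (h1 : κ < 1) :
    ∫⁻ η, expTotal κ (gammaPoints η) ∂(gammaNoise m) < ⊤ := by
  have hF := isGammaMultiplier_exp (X := X) h0 h1
  obtain ⟨B, hB⟩ := (hF.tendsto_prodMean (m := m)).bddAbove_range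
  have hm : ∀ n, Measurable fun η : ℕ → (Rpos × Rpos) × X =>
      ∏ k ∈ Finset.range n, Real.exp (κ * (gammaPoints η k).1) := fun n => by
    refine Finset.measurable_fun_prod _ fun k _ => ?_
    have := (measurable_pi_apply k).comp (measurable_gammaPoints (X := X))
    exact Real.measurable_exp.comp (measurable_const.mul (measurable_subtype_coe.comp this.fst))
  unfold expTotal
  rw [lintegral_iSup (fun n => (hm n).ennreal_ofReal)]
  · refine lt_of_le_of_lt (iSup_le fun n => ?_) (ENNReal.ofReal_lt_top (r := B))
    rw [← ofReal_integral_eq_lintegral_ofReal]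
    · refine ENNReal.ofReal_le_ofReal ?_
      have := hB ⟨n, rfl⟩
      simpa [prodMean, expNeg_zero] using this
    · refine Integrable.mono' (integrable_exp_noise h1 n) (hm n).aestronglyMeasurable
        (Eventually.of_forall fun η => ?_)
      simpa [expNeg_zero] using hF.norm_prod_le le_rfl n η
    · exact Eventually.of_forall fun η => Finset.prod_nonneg fun _ _ => (Real.exp_pos _).le
  · refine monotone_nat_of_le_succ fun n η => ENNReal.ofReal_le_ofReal ?_
    rw [Finset.prod_range_succ]
    exact le_mul_of_one_le_right (Finset.prod_nonneg fun _ _ => (Real.exp_pos _).le)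
      (Real.one_le_exp (mul_nonneg h0 (gammaPoints η n).1.2.le))

lemma ae_summable_gammaPoints :
    ∀ᵐ η ∂(gammaNoise m), Summable fun k => ((gammaPoints η k).1 : ℝ) := by
  filter_upwards [ae_lt_top ((measurable_expTotal (1 / 2)).comp measurable_gammaPoints)
    (lintegral_expTotal_gammaPoints_lt_top (m := m) (by norm_num) (by norm_num)).ne] with η hη
  refine summable_of_sum_range_le (c := 2 * (expTotal (1 / 2) (gammaPoints η)).toReal)
    (fun k => (gammaPoints η k).1.2.le) fun n => ?_
  have h1 : ENNReal.ofReal (∏ k ∈ Finset.range n, Real.exp (1 / 2 * (gammaPoints η k).1))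
      ≤ expTotal (1 / 2) (gammaPoints η) :=
    le_iSup (fun n => ENNReal.ofReal (∏ k ∈ Finset.range n,
      Real.exp (1 / 2 * (gammaPoints η k).1))) n
  have h2 : _ ≤ (expTotal (1 / 2) (gammaPoints η)).toReal :=
    (ENNReal.ofReal_le_iff_le_toReal (ne_of_lt hη)).1 h1
  rw [← Real.exp_sum, ← Finset.mul_sum] at h2
  -- `t + 1 ≤ e^t` turns the bound on the exponentials into one on the partial sums.
  have h3 := Real.add_one_le_exp
    (1 / 2 * ∑ k ∈ Finset.range n, ((gammaPoints η k).1 : ℝ))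
  linarith

/-- The gamma process is the law of `gammaPoints`: the restriction to summable sequences in its
definition loses nothing. -/
lemma map_val_gammaMeasure :
    (gammaMeasure m).map Subtype.val = (gammaNoise m).map gammaPoints := by
  rw [gammaMeasure, measurableEmbedding_config.map_comap, Measure.restrict_eq_self_of_ae_mem]
  · rfl
  rw [show range (Subtype.val : Config X → ℕ → Rpos × X) = _ from Subtype.range_coe]
  exact (ae_map_iff measurable_gammaPoints.aemeasurable measurableSet_summable_weights).2
    ae_summable_gammaPoints

instance : IsProbabilityMeasure (gammaMeasure m) := by
  have h1 : IsProbabilityMeasure ((gammaMeasure m).map Subtype.val) := by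
    rw [map_val_gammaMeasure]
    exact Measure.isProbabilityMeasure_map measurable_gammaPoints.aemeasurable
  exact Measure.isProbabilityMeasure_of_map Subtype.val

lemma integrable_exp_total (h0 : 0 ≤ κ) (h1 : κ < 1) :
    Integrable (fun ω : Config X => Real.exp (κ * ∑' k, (ω.r k : ℝ))) (gammaMeasure m) := by
  have hm : Measurable fun ω : Config X => Real.exp (κ * ∑' k, (ω.r k : ℝ)) := by
    have : Measurable fun ω : Config X => ∑' k, (ω.r k : ℝ) :=
      Measurable.tsum fun k => by fun_prop
    fun_prop
  refine ⟨hm.aestronglyMeasurable, ?_⟩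
  rw [hasFiniteIntegral_iff_ofReal (Eventually.of_forall fun _ => (Real.exp_pos _).le)]
  simp_rw [← Config.expTotal_eq h0]
  rw [← measurableEmbedding_config.lintegral_map, map_val_gammaMeasure, lintegral_map
    (measurable_expTotal κ) measurable_gammaPoints]
  exact lintegral_expTotal_gammaPoints_lt_top h0 h1

lemma IsGammaMultiplier.multipliable (hF : IsGammaMultiplier F κ C) (ω : Config X) :
    Multipliable fun k => F (ω.r k) (ω.x k) := by
  have hs : Summable fun k => ‖F (ω.r k) (ω.x k) - 1‖ := by
    refine Summable.of_nonneg_of_le (fun _ => norm_nonneg _) (fun k => ?_)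
      ((ω.2.mul_left (C * Real.exp (κ * ∑' k, (ω.r k : ℝ)))))
    refine (hF.norm_sub_one_le _ _).trans ?_
    have h1 : ((ω.1 k).1 : ℝ) ≤ ∑' k, (ω.r k : ℝ) := ω.2.le_tsum k fun j _ => (ω.1 j).1.2.le
    have h2 := hF.const_nonneg
    have h3 := hF.nonneg
    have h4 : (0 : ℝ) < (ω.1 k).1 := (ω.1 k).1.2
    change C * (((ω.1 k).1 : ℝ) * Real.exp (κ * (ω.1 k).1)) ≤ _
    calc C * (((ω.1 k).1 : ℝ) * Real.exp (κ * (ω.1 k).1))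
        ≤ C * (((ω.1 k).1 : ℝ) * Real.exp (κ * ∑' k, (ω.r k : ℝ))) := by gcongr
      _ = _ := by ring
  simpa using multipliable_one_add_of_summable hs

lemma IsGammaMultiplier.norm_prod_range_le (hF : IsGammaMultiplier F κ C) (ω : Config X) (n : ℕ) :
    ‖∏ k ∈ Finset.range n, F (ω.r k) (ω.x k)‖ ≤ Real.exp (κ * ∑' k, (ω.r k : ℝ)) := by
  rw [norm_prod]
  calc ∏ k ∈ Finset.range n, ‖F (ω.r k) (ω.x k)‖
      ≤ ∏ k ∈ Finset.range n, Real.exp (κ * ω.r k) :=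
        Finset.prod_le_prod (fun _ _ => norm_nonneg _) fun k _ => hF.norm_le _ _
    _ ≤ _ := by
        rw [← Real.exp_sum, ← Finset.mul_sum]
        refine Real.exp_le_exp.2 (mul_le_mul_of_nonneg_left ?_ hF.nonneg)
        exact ω.2.sum_le_tsum _ fun j _ => (ω.1 j).1.2.le

lemma IsGammaMultiplier.stronglyMeasurable_config (hF : IsGammaMultiplier F κ C) (n : ℕ) :
    StronglyMeasurable fun ω : Config X => ∏ k ∈ Finset.range n, F (ω.r k) (ω.x k) :=
  Finset.stronglyMeasurable_fun_prod _ fun k _ =>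
    hF.stronglyMeasurable.comp_measurable ((measurable_config_r k).prodMk (measurable_config_x k))

lemma IsGammaMultiplier.integral_prod_gammaMeasure (hF : IsGammaMultiplier F κ C) (n : ℕ) :
    ∫ ω, ∏ k ∈ Finset.range n, F (ω.r k) (ω.x k) ∂(gammaMeasure m) = prodMean m F n 0 := by
  have hm : StronglyMeasurable fun ζ : ℕ → Rpos × X =>
      ∏ k ∈ Finset.range n, F (ζ k).1 (ζ k).2 :=
    Finset.stronglyMeasurable_fun_prod _ fun k _ =>
      hF.stronglyMeasurable.comp_measurable (measurable_pi_apply k)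
  refine (measurableEmbedding_config.integral_map (μ := gammaMeasure m)
    (fun ζ : ℕ → Rpos × X => ∏ k ∈ Finset.range n, F (ζ k).1 (ζ k).2)).symm.trans ?_
  rw [map_val_gammaMeasure, integral_map measurable_gammaPoints.aemeasurable
    hm.aestronglyMeasurable, prodMean]
  simp [expNeg_zero]

/-- Campbell's formula for multiplicative functionals of the gamma process. -/
theorem IsGammaMultiplier.integral_tprod (hF : IsGammaMultiplier F κ C) :
    Integrable (fun ω : Config X => ∏' k, F (ω.r k) (ω.x k)) (gammaMeasure m) ∧
    ∫ ω : Config X, ∏' k, F (ω.r k) (ω.x k) ∂(gammaMeasure m)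
      = NormedSpace.exp (∫ q, (F q.1 q.2 - 1) ∂(levyPos.prod m)) := by
  have hlim : ∀ ω : Config X, Tendsto (fun n => ∏ k ∈ Finset.range n, F (ω.r k) (ω.x k)) atTop
      (𝓝 (∏' k, F (ω.r k) (ω.x k))) := fun ω => (hF.multipliable ω).hasProd.tendsto_prod_nat
  have hb := integrable_exp_total (m := m) hF.nonneg hF.lt_one
  constructor
  · refine Integrable.mono' hb (aestronglyMeasurable_of_tendsto_ae atTop
      (fun n => (hF.stronglyMeasurable_config n).aestronglyMeasurable)
      (Eventually.of_forall hlim)) (Eventually.of_forall fun ω => ?_)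
    exact le_of_tendsto (hlim ω).norm (Eventually.of_forall fun n => hF.norm_prod_range_le ω n)
  · have h1 := tendsto_integral_of_dominated_convergence _
      (fun n => (hF.stronglyMeasurable_config n).aestronglyMeasurable) hb
      (fun n => Eventually.of_forall fun ω => hF.norm_prod_range_le ω n)
      (Eventually.of_forall hlim)
    simp_rw [hF.integral_prod_gammaMeasure] at h1
    rw [← hF.integral_pointMean_sub_one]
    exact tendsto_nhds_unique h1 hF.tendsto_prodMean

end Configurations

/-! ### The Laplace transform of the infinite-dimensional Lebesgue measure -/

section Laplace

lemma abs_exp_sub_one_le_abs_mul_exp {a b : ℝ} (hab : a ≤ b) (hb : 0 ≤ b) :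
    |Real.exp a - 1| ≤ |a| * Real.exp b := by
  have h1 := Real.add_one_le_exp (-a)
  have h2 := Real.add_one_le_exp a
  have h3 : Real.exp a * Real.exp (-a) = 1 := by rw [← Real.exp_add]; simp
  have h4 := Real.exp_le_exp.2 hab
  have h5 := Real.one_le_exp hb
  have h6 := Real.exp_pos a
  rcases le_total 0 a with h | h
  · rw [abs_of_nonneg h, abs_of_nonneg (by linarith)]
    nlinarith
  · rw [abs_of_nonpos h, abs_of_nonpos (by linarith [Real.exp_le_one_iff.2 h])]
    nlinarith

lemma integrable_exp_sub_one_levyPos {β : ℝ} (hβ : β < 1) :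
    Integrable (fun r : Rpos => Real.exp (β * r) - 1) levyPos := by
  refine Integrable.mono' ((integrable_mul_exp_mul_levyPos (κ := max β 0)
    (max_lt hβ one_pos)).const_mul |β|) (by fun_prop) (Eventually.of_forall fun r => ?_)
  have hr : (0 : ℝ) < r := r.2
  refine (abs_exp_sub_one_le_abs_mul_exp (b := max β 0 * r)
    (mul_le_mul_of_nonneg_right (le_max_left _ _) hr.le) (by positivity)).trans_eq ?_
  rw [abs_mul, abs_of_pos hr, mul_assoc]

/-- Frullani's integral, written for the Lévy measure. -/
lemma integral_exp_sub_one_levyPos {β : ℝ} (hβ : β < 1) :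
    ∫ r : Rpos, (Real.exp (β * r) - 1) ∂levyPos = -Real.log (1 - β) := by
  have e : ∀ r : ℝ, (r⁻¹ * Real.exp (-r)) • (Real.exp (β * r) - 1)
      = r⁻¹ • (Real.exp (-((1 - β) * r)) - Real.exp (-(1 * r))) := fun r => by
    have : Real.exp (-((1 - β) * r)) = Real.exp (-r) * Real.exp (β * r) := by
      rw [← Real.exp_add]; ring_nf
    rw [this]
    simp only [smul_eq_mul, one_mul]
    ring
  have hi := (integrable_levyPos_iff (fun r => Real.exp (β * r) - 1)).1
    (integrable_exp_sub_one_levyPos hβ)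
  simp_rw [e] at hi
  refine (integral_lebPos_withDensity (ρ := fun r => r⁻¹ * Real.exp (-r)) (by fun_prop)
    (fun r hr => by positivity) (fun r => Real.exp (β * r) - 1)).trans ?_
  simp_rw [e]
  have hc : Continuous fun r : ℝ => Real.exp (-r) := by fun_prop
  rw [Frullani.integral_Ioi_eq (f := fun r => Real.exp (-r)) (L := 1) (R := 0)
    (hc.locallyIntegrable.locallyIntegrableOn _) (by linarith) one_pos
    ((by simpa using hc.tendsto 0 : Tendsto (fun r : ℝ => Real.exp (-r)) (𝓝 0) (𝓝 1)).mono_left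
      nhdsWithin_le_nhds) Real.tendsto_exp_neg_atTop_nhds_zero hi]
  simp

variable {X : Type*}

lemma Config.summable_mul {f : X → ℝ} {b : ℝ} (hf : ∀ x, |f x| ≤ b) (ω : Config X) :
    Summable fun k => (ω.r k : ℝ) * f (ω.x k) := by
  refine Summable.of_norm_bounded (ω.2.mul_right b) fun k => ?_
  rw [Real.norm_eq_abs, abs_mul, abs_of_pos (ω.r k).2]
  exact mul_le_mul_of_nonneg_left (hf _) (ω.r k).2.le

variable [MeasurableSpace X]

lemma isGammaMultiplier_exp_mul {β : X → ℝ} {κ C : ℝ} (hβ : Measurable β) (h0 : 0 ≤ κ) (h1 : κ < 1)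
    (hβκ : ∀ x, β x ≤ κ) (hC : 0 ≤ C) (hβC : ∀ x, |β x| ≤ C) :
    IsGammaMultiplier (fun (r : Rpos) (x : X) => Real.exp (β x * r)) κ C where
  nonneg := h0
  lt_one := h1
  const_nonneg := hC
  cont _ := by fun_prop
  meas _ := Measurable.stronglyMeasurable (by fun_prop)
  norm_le r x := by
    rw [Real.norm_of_nonneg (Real.exp_pos _).le]
    exact Real.exp_le_exp.2 (mul_le_mul_of_nonneg_right (hβκ x) r.2.le)
  norm_sub_one_le r x := by
    have hr : (0 : ℝ) < r := r.2
    refine (abs_exp_sub_one_le_abs_mul_exp (b := κ * r)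
      (mul_le_mul_of_nonneg_right (hβκ x) hr.le) (by positivity)).trans ?_
    rw [abs_mul, abs_of_pos hr, mul_assoc]
    gcongr
    exact hβC x

lemma measurable_config_total : Measurable fun ω : Config X => ∑' k, (ω.r k : ℝ) :=
  Measurable.tsum fun k => by fun_prop

variable (m : Measure X) [IsProbabilityMeasure m]

/-- The Laplace transform of the infinite-dimensional Lebesgue measure. -/
theorem lintegral_lebesgueInf {f : X → ℝ} (hf : Measurable f) {a b : ℝ} (ha : 0 < a)
    (hab : ∀ x, a ≤ f x ∧ f x ≤ b) :
    ∫⁻ ω, ENNReal.ofReal (Real.exp (-∑' k, (ω.r k : ℝ) * f (ω.x k))) ∂(lebesgueInf m)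
      = ENNReal.ofReal (Real.exp (-∫ x, Real.log (f x) ∂m)) := by
  have hfb : ∀ x, |f x| ≤ b := fun x => abs_le.2 ⟨by linarith [hab x], (hab x).2⟩
  have hF : IsGammaMultiplier (fun (r : Rpos) (x : X) => Real.exp ((1 - f x) * r))
      (max (1 - a) 0) (1 + |b|) := by
    refine isGammaMultiplier_exp_mul (by fun_prop) (le_max_right _ _) (by simp [ha])
      (fun x => ?_) (by positivity) fun x => ?_
    · exact le_max_of_le_left (by linarith [hab x])
    · refine (abs_sub _ _).trans ?_
      rw [abs_one]
      linarith [(hfb x).trans (le_abs_self b)]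
  have hm : Measurable fun ω : Config X => ∑' k, (ω.r k : ℝ) * f (ω.x k) :=
    Measurable.tsum fun k => by fun_prop
  have hm2 := measurable_config_total (X := X)
  rw [lebesgueInf, lintegral_withDensity_eq_lintegral_mul _ (by fun_prop) (by fun_prop)]
  have e : ∀ ω : Config X, ((fun ω : Config X => ENNReal.ofReal (Real.exp (∑' k, (ω.r k : ℝ))))
      * fun ω : Config X => ENNReal.ofReal (Real.exp (-∑' k, (ω.r k : ℝ) * f (ω.x k)))) ω
      = ENNReal.ofReal (∏' k, Real.exp ((1 - f (ω.x k)) * ω.r k)) := by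
    intro ω
    have h1 : HasSum (fun k => (1 - f (ω.x k)) * (ω.r k : ℝ))
        (∑' k, (ω.r k : ℝ) - ∑' k, (ω.r k : ℝ) * f (ω.x k)) := by
      refine (ω.2.hasSum.sub (ω.summable_mul hfb).hasSum).congr_fun fun k => ?_
      change _ = (ω.r k : ℝ) - _
      ring
    have h2 := h1.rexp.tprod_eq
    rw [Pi.mul_apply, ← ENNReal.ofReal_mul (Real.exp_pos _).le, ← Real.exp_add, ← sub_eq_add_neg,
      ← h2]
    rfl
  rw [lintegral_congr e]
  obtain ⟨hi, he⟩ := hF.integral_tprod (m := m)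
  rw [← ofReal_integral_eq_lintegral_ofReal hi (Eventually.of_forall fun ω => ?_), he,
    ← Real.exp_eq_exp_ℝ, integral_prod_symm _ hF.integrable_levy]
  · congr 2
    rw [← integral_neg]
    refine integral_congr_ae (Eventually.of_forall fun x => ?_)
    simp only
    rw [integral_exp_sub_one_levyPos (by linarith [hab x])]
    simp
  · exact ge_of_tendsto (hF.multipliable ω).hasProd.tendsto_prod_nat
      (Eventually.of_forall fun n => Finset.prod_nonneg fun _ _ => (Real.exp_pos _).le)

end Laplace

/-! ### Measurability of elementary tensors -/

section TensorMeasurability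

variable {𝕜 : Type*} [RCLike 𝕜] {H : Type*} [NormedAddCommGroup H] [InnerProductSpace 𝕜 H]
variable {h : {h : H // ‖h‖ = 1}}

lemma inner_stabilizing_self : (inner 𝕜 h.1 h.1 : 𝕜) = 1 := by
  rw [inner_self_eq_norm_sq_to_K, h.2]; simp

lemma norm_tmk_sub_sq (f f' : Family h.1) :
    ‖tmk 𝕜 f - tmk 𝕜 f'‖ ^ 2 = RCLike.re (∏' k, (inner 𝕜 (f.1 k) (f.1 k) : 𝕜))
      - 2 * RCLike.re (∏' k, (inner 𝕜 (f.1 k) (f'.1 k) : 𝕜))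
      + RCLike.re (∏' k, (inner 𝕜 (f'.1 k) (f'.1 k) : 𝕜)) := by
  rw [norm_sub_sq (𝕜 := 𝕜), ← inner_tmk, ← inner_tmk, ← inner_tmk,
    inner_self_eq_norm_sq, inner_self_eq_norm_sq]

/-- The family `w₀, …, w_{n-1}, h, h, …`. -/
def truncFamily (h : {h : H // ‖h‖ = 1}) (n : ℕ) (w : ℕ → H) : Family h.1 :=
  ⟨fun k => if k < n then w k else h.1,
    summable_of_ne_finset_zero (s := Finset.range n) fun k hk => by
      rw [Finset.mem_range] at hk
      simp [hk]⟩

lemma tprod_inner_truncFamily (n : ℕ) (w w' : ℕ → H) :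
    ∏' k, (inner 𝕜 ((truncFamily h n w).1 k) ((truncFamily h n w').1 k) : 𝕜)
      = ∏ k ∈ Finset.range n, inner 𝕜 (w k) (w' k) := by
  rw [tprod_eq_prod (s := Finset.range n)]
  · refine Finset.prod_congr rfl fun k hk => ?_
    simp [truncFamily, Finset.mem_range.1 hk]
  · intro k hk
    rw [Finset.mem_range] at hk
    simp [truncFamily, hk, h.2]

/-- The squared distance of two truncated tensors is a polynomial in finitely many inner
products. -/
lemma continuous_tmk_truncFamily (n : ℕ) :
    Continuous fun w : ℕ → H => tmk 𝕜 (truncFamily h n w) := by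
  refine continuous_iff_continuousAt.2 fun w => ?_
  rw [ContinuousAt, tendsto_iff_norm_sub_tendsto_zero]
  have h2 : Tendsto (fun w' => ‖tmk 𝕜 (truncFamily h n w') - tmk 𝕜 (truncFamily h n w)‖ ^ 2) (𝓝 w)
      (𝓝 0) := by
    simp_rw [norm_tmk_sub_sq, tprod_inner_truncFamily]
    have hc : Continuous fun w' : ℕ → H =>
        RCLike.re (∏ k ∈ Finset.range n, (inner 𝕜 (w' k) (w' k) : 𝕜))
        - 2 * RCLike.re (∏ k ∈ Finset.range n, (inner 𝕜 (w' k) (w k) : 𝕜))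
        + RCLike.re (∏ k ∈ Finset.range n, (inner 𝕜 (w k) (w k) : 𝕜)) := by
      fun_prop
    have := hc.tendsto w
    refine this.trans_eq ?_
    congr 1
    ring
  have := h2.sqrt
  simpa using this

lemma stronglyMeasurable_truncSeq {A : Type*} [MeasurableSpace A] {v : ℕ → A → H} (b : H)
    (hv : ∀ k, StronglyMeasurable (v k)) (n : ℕ) :
    StronglyMeasurable fun a => (fun k => if k < n then v k a else b : ℕ → H) := by
  induction n with
  | zero => simpa using stronglyMeasurable_const
  | succ n ih =>
    have hc : Continuous fun q : (ℕ → H) × H => Function.update q.1 n q.2 := by fun_prop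
    convert hc.comp_stronglyMeasurable (ih.prodMk (hv n)) using 1
    ext a k
    rcases lt_trichotomy k n with hk | hk | hk
    · simp [hk, hk.ne, Nat.lt_succ_of_lt hk]
    · simp [hk]
    · simp [hk.ne', not_lt.2 hk.le, not_lt.2 (Nat.succ_le_of_lt hk)]

lemma Family.summable_inner_sub_one (f f' : Family h.1) :
    Summable fun k => ‖(inner 𝕜 (f.1 k) (f'.1 k) : 𝕜) - 1‖ := by
  obtain ⟨c, hc⟩ := f.2.tendsto_atTop_zero.bddAbove_range
  refine Summable.of_nonneg_of_le (fun _ => norm_nonneg _) (fun k => ?_)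
    (f.2.add (f'.2.mul_left (c + 1)))
  have e : (inner 𝕜 (f.1 k) (f'.1 k) : 𝕜) - 1
      = inner 𝕜 (f.1 k - h.1) h.1 + inner 𝕜 (f.1 k) (f'.1 k - h.1) := by
    rw [inner_sub_left, inner_sub_right, inner_stabilizing_self]; ring
  have hf : ‖f.1 k‖ ≤ c + 1 := by
    calc ‖f.1 k‖ = ‖(f.1 k - h.1) + h.1‖ := by simp
      _ ≤ ‖f.1 k - h.1‖ + ‖h.1‖ := norm_add_le _ _
      _ ≤ c + 1 := by rw [h.2]; gcongr; exact hc ⟨k, rfl⟩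
  rw [e]
  refine (norm_add_le _ _).trans (add_le_add ?_ ?_)
  · simpa [h.2] using norm_inner_le_norm (𝕜 := 𝕜) (f.1 k - h.1) h.1
  · exact (norm_inner_le_norm _ _).trans (by gcongr)

lemma tendsto_tmk_truncFamily (f : Family h.1) :
    Tendsto (fun n => tmk 𝕜 (truncFamily h n f.1)) atTop (𝓝 (tmk 𝕜 f)) := by
  -- Dominated convergence for the inner products `⟪g n, g' n⟫` of two families that tend to
  -- `f` and `f'` coordinatewise, each factor being that of `f, f'` or that of `h, f'`.
  have hone : ∀ (f f' : Family h.1) (g g' : ℕ → Family h.1)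
      (_ : ∀ k, ∀ᶠ n in atTop, (g n).1 k = f.1 k ∧ (g' n).1 k = f'.1 k)
      (_ : ∀ n k, ‖(inner 𝕜 ((g n).1 k) ((g' n).1 k) : 𝕜) - 1‖
        ≤ ‖(inner 𝕜 (f.1 k) (f'.1 k) : 𝕜) - 1‖ + ‖(inner 𝕜 h.1 (f'.1 k) : 𝕜) - 1‖),
      Tendsto (fun n => ∏' k, (inner 𝕜 ((g n).1 k) ((g' n).1 k) : 𝕜)) atTop
        (𝓝 (∏' k, (inner 𝕜 (f.1 k) (f'.1 k) : 𝕜))) := by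
    intro f f' g g' h1 h2
    have := tendsto_tprod_one_add_of_dominated_convergence (𝓕 := atTop)
      (f := fun n k => (inner 𝕜 ((g n).1 k) ((g' n).1 k) : 𝕜) - 1)
      (g := fun k => (inner 𝕜 (f.1 k) (f'.1 k) : 𝕜) - 1)
      ((Family.summable_inner_sub_one f f').add
        (Family.summable_inner_sub_one ⟨fun _ => h.1, by simp⟩ f'))
      (fun k => tendsto_const_nhds.congr' ((h1 k).mono fun n hn => by simp only [hn.1, hn.2]))
      (Eventually.of_forall fun n k => h2 n k)
    simpa using this
  have hev : ∀ k, ∀ᶠ n in atTop, (truncFamily h n f.1).1 k = f.1 k := fun k => by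
    filter_upwards [eventually_gt_atTop k] with n hn
    simp [truncFamily, hn]
  rw [tendsto_iff_norm_sub_tendsto_zero]
  have h2 : Tendsto (fun n => ‖tmk 𝕜 (truncFamily h n f.1) - tmk 𝕜 f‖ ^ 2) atTop (𝓝 0) := by
    simp_rw [norm_tmk_sub_sq]
    have t1 := hone f f (fun n => truncFamily h n f.1) (fun n => truncFamily h n f.1)
      (fun k => (hev k).mono fun n hn => ⟨hn, hn⟩) (fun n k => by
        by_cases hk : k < n
        · simp [truncFamily, hk]
        · simp only [truncFamily, hk, if_false, inner_stabilizing_self, sub_self, norm_zero]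
          positivity)
    have t2 := hone f f (fun n => truncFamily h n f.1) (fun _ => f)
      (fun k => (hev k).mono fun n hn => ⟨hn, rfl⟩) (fun n k => by
        by_cases hk : k < n
        · simp [truncFamily, hk]
        · simp [truncFamily, hk])
    have t := ((RCLike.continuous_re.tendsto _).comp t1).sub
      (((RCLike.continuous_re.tendsto _).comp t2).const_mul 2) |>.add_const
      (RCLike.re (∏' k, (inner 𝕜 (f.1 k) (f.1 k) : 𝕜)))
    refine t.trans_eq ?_
    congr 1
    ring
  have := h2.sqrt
  simpa using this

/-- An elementary tensor depends measurably on its factors. -/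
lemma stronglyMeasurable_tmk {A : Type*} [MeasurableSpace A] {f : A → Family h.1}
    (hf : ∀ k, StronglyMeasurable fun a => (f a).1 k) :
    StronglyMeasurable fun a => tmk 𝕜 (f a) := by
  refine stronglyMeasurable_of_tendsto atTop (f := fun n a => tmk 𝕜 (truncFamily h n (f a).1))
    (fun n => ?_) (tendsto_pi_nhds.2 fun a => tendsto_tmk_truncFamily (f a))
  convert (continuous_tmk_truncFamily (𝕜 := 𝕜) (h := h) n).comp_stronglyMeasurable
    (stronglyMeasurable_truncSeq h.1 hf n) using 1
  ext a
  congr 1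
  refine Subtype.ext (funext fun k => ?_)
  by_cases hk : k < n <;> simp [truncFamily, hk]

lemma permOp_tmk (σ : Equiv.Perm ℕ) (f : Family h.1) :
    permOp 𝕜 σ (tmk 𝕜 f) = tmk 𝕜 (f.reindex σ) :=
  tensorMap_tmk 𝕜 _ _ f

lemma tensorOp_tmk (A : ℕ → H ≃ₗᵢ[𝕜] H) (hA : Summable fun k => ‖A k h.1 - h.1‖)
    (f : Family h.1) : tensorOp A (tmk 𝕜 f) = tmk 𝕜 (f.act A hA) := by
  rw [tensorOp, dif_pos hA, tensorMap_tmk]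

end TensorMeasurability

/-! ### Canonical representations -/

section Canonical

variable {𝕜 : Type*} [RCLike 𝕜] {H : Type*} [NormedAddCommGroup H] [InnerProductSpace 𝕜 H]
variable {P₀ : Type*} [Group P₀] {α : Rpos →* MulAut P₀} {T : P₀ →* (H ≃ₗᵢ[𝕜] H)}
variable {h : {h : H // ‖h‖ = 1}}

/-- `‖T(p^r) h - h‖ ≤ L r` for all `r > 0`. -/
def IsAlmostInvariant (α : Rpos →* MulAut P₀) (T : P₀ →* (H ≃ₗᵢ[𝕜] H)) (h : {h : H // ‖h‖ = 1})
    (L : ℝ) (p : P₀) : Prop :=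
  ∀ r : Rpos, ‖T (α r p) h.1 - h.1‖ ≤ L * r

lemma IsAlmostInvariant.mono {L L' : ℝ} {p : P₀} (hp : IsAlmostInvariant α T h L p) (hL : L ≤ L') :
    IsAlmostInvariant α T h L' p :=
  fun r => (hp r).trans (mul_le_mul_of_nonneg_right hL r.2.le)

lemma IsAlmostInvariant.mul {L L' : ℝ} {p q : P₀} (hp : IsAlmostInvariant α T h L p)
    (hq : IsAlmostInvariant α T h L' q) : IsAlmostInvariant α T h (L + L') (p * q) := fun r => by
  have e : T (α r (p * q)) h.1 - h.1
      = T (α r p) (T (α r q) h.1 - h.1) + (T (α r p) h.1 - h.1) := by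
    rw [map_mul, map_mul, map_sub, LinearIsometryEquiv.coe_mul, Function.comp_apply]
    abel
  rw [e, add_comm L, add_mul]
  refine (norm_add_le _ _).trans (add_le_add ?_ (hp r))
  rw [LinearIsometryEquiv.norm_map]
  exact hq r

lemma IsAlmostInvariant.inv {L : ℝ} {p : P₀} (hp : IsAlmostInvariant α T h L p) :
    IsAlmostInvariant α T h L p⁻¹ := fun r => by
  have e : T (α r p) (T (α r p⁻¹) h.1 - h.1) = h.1 - T (α r p) h.1 := by
    have e1 : T (α r p) * T (α r p⁻¹) = 1 := by
      rw [← map_mul, ← map_mul, mul_inv_cancel, map_one, map_one]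
    rw [map_sub]
    exact congrArg (· - _) (DFunLike.congr_fun e1 h.1)
  rw [← LinearIsometryEquiv.norm_map (T (α r p)), e, norm_sub_rev]
  exact hp r

lemma norm_apply_sub_le_two (p : P₀) : ‖T p h.1 - h.1‖ ≤ 2 := by
  refine (norm_sub_le _ _).trans ?_
  rw [LinearIsometryEquiv.norm_map, h.2]
  norm_num

/-- The bound for small `r` extends to all `r > 0`, because `‖T(p) h - h‖ ≤ 2`. -/
lemma IsCanonical.exists_isAlmostInvariant (hT : IsCanonical α T h) (p : P₀) :
    ∃ L, IsAlmostInvariant α T h L p := by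
  obtain ⟨c, δ, hδ, hc⟩ := hT.2 p
  refine ⟨max c (2 / δ), fun r => ?_⟩
  have hr : (0 : ℝ) < r := r.2
  rcases lt_or_ge (r : ℝ) δ with h1 | h1
  · exact (hc r h1).le.trans (mul_le_mul_of_nonneg_right (le_max_left _ _) hr.le)
  · refine (norm_apply_sub_le_two _).trans ?_
    calc (2 : ℝ) ≤ 2 / δ * r := by
          rw [div_mul_eq_mul_div, le_div_iff₀ hδ]
          linarith
      _ ≤ _ := mul_le_mul_of_nonneg_right (le_max_right _ _) hr.le

variable [TopologicalSpace P₀]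

lemma continuous_apply_stabilizing (hα : Continuous fun q : Rpos × P₀ => α q.1 q.2)
    (hTcont : ∀ v : H, Continuous fun p : P₀ => T p v) :
    Continuous fun q : Rpos × P₀ => T (α q.1 q.2) h.1 :=
  (hTcont h.1).comp hα

/-- The constants in the definition of a canonical representation can be chosen uniformly on compact
sets. The sets on which a given constant works are closed and cover the group, so by Baire's theorem
one of them has interior points; subadditivity in the group element does the rest. -/
lemma IsCanonical.exists_isAlmostInvariant_of_isCompact [IsTopologicalGroup P₀]
    [LocallyCompactSpace P₀] (hα : Continuous fun q : Rpos × P₀ => α q.1 q.2)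
    (hTcont : ∀ v : H, Continuous fun p : P₀ => T p v) (hT : IsCanonical α T h)
    {K : Set P₀} (hK : IsCompact K) : ∃ L, ∀ p ∈ K, IsAlmostInvariant α T h L p := by
  have hcont := continuous_apply_stabilizing (h := h) hα hTcont
  have hcl : ∀ n : ℕ, IsClosed {p | IsAlmostInvariant α T h n p} := fun n => by
    simp only [IsAlmostInvariant, ofPred_forall]
    refine isClosed_iInter fun r => isClosed_le ?_ continuous_const
    exact ((hcont.comp (by fun_prop : Continuous fun p : P₀ => (r, p))).sub continuous_const).norm
  have hun : ⋃ n : ℕ, {p | IsAlmostInvariant α T h n p} = univ := by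
    refine eq_univ_of_forall fun p => ?_
    obtain ⟨L, hL⟩ := hT.exists_isAlmostInvariant p
    obtain ⟨n, hn⟩ := exists_nat_ge L
    exact mem_iUnion.2 ⟨n, hL.mono hn⟩
  obtain ⟨n, p₀, hp₀⟩ := nonempty_interior_of_iUnion_of_closed hcl hun
  refine hK.induction_on (p := fun s => ∃ L, ∀ p ∈ s, IsAlmostInvariant α T h L p) ?_ ?_ ?_ ?_
  · exact ⟨0, by simp⟩
  · rintro s t hst ⟨L, hL⟩
    exact ⟨L, fun p hp => hL p (hst hp)⟩
  · rintro s t ⟨L, hL⟩ ⟨L', hL'⟩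
    refine ⟨max L L', fun p hp => ?_⟩
    rcases hp with hp | hp
    · exact (hL p hp).mono (le_max_left _ _)
    · exact (hL' p hp).mono (le_max_right _ _)
  · intro q _
    obtain ⟨L, hL⟩ := hT.exists_isAlmostInvariant q
    obtain ⟨L₀, hL₀⟩ := hT.exists_isAlmostInvariant p₀
    refine ⟨(fun x => p₀ * q⁻¹ * x) ⁻¹' interior {p | IsAlmostInvariant α T h n p},
      mem_nhdsWithin_of_mem_nhds ((isOpen_interior.preimage (by fun_prop)).mem_nhds ?_),
      L + L₀ + n, fun p hp => ?_⟩
    · simpa using hp₀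
    -- `p = (q p₀⁻¹) (p₀ q⁻¹ p)`, and the constant `n` works for the second factor.
    · have h1 : IsAlmostInvariant α T h n (p₀ * q⁻¹ * p) := interior_subset hp
      have h2 := (hL.mul hL₀.inv).mul h1
      have e : q * p₀⁻¹ * (p₀ * q⁻¹ * p) = p := by group
      rwa [e] at h2

variable [MeasurableSpace P₀] {X : Type*} [MeasurableSpace X]

lemma Current.exists_le_right {α : Rpos →* MulAut P₀} (g : Current α X) :
    ∃ a : ℝ, 0 < a ∧ ∀ x, a ≤ (g.toFun x).right := by
  obtain ⟨K, hK, hg⟩ := g.bounded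
  rcases K.eq_empty_or_nonempty with rfl | hne
  · exact ⟨1, one_pos, fun x => (hg x).elim⟩
  · obtain ⟨q, _, hq⟩ := hK.exists_isMinOn hne
      (f := fun q : P₀ × Rpos => (q.2 : ℝ)) (by fun_prop)
    exact ⟨q.2, q.2.2, fun x => hq (hg x)⟩

variable [BorelSpace P₀]

/-- `T(p(x)^r) h` is strongly measurable in `x`: its values lie in the image of a compact set, which
is separable even if `H` is not. -/
lemma Current.stronglyMeasurable_apply (hα : Continuous fun q : Rpos × P₀ => α q.1 q.2)
    (hTcont : ∀ v : H, Continuous fun p : P₀ => T p v) (g : Current α X) :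
    StronglyMeasurable fun q : Rpos × X => T (α q.1 (g.toFun q.2).left) h.1 := by
  have hcont := continuous_apply_stabilizing (h := h) hα hTcont
  refine stronglyMeasurable_uncurry_of_continuous_of_stronglyMeasurable
    (u := fun (r : Rpos) (x : X) => T (α r (g.toFun x).left) h.1)
    (fun x => hcont.comp (by fun_prop : Continuous fun r : Rpos => (r, (g.toFun x).left)))
    fun r => ?_
  have hc : Continuous fun p : P₀ => T (α r p) h.1 :=
    hcont.comp (by fun_prop : Continuous fun p : P₀ => (r, p))
  borelize H
  refine stronglyMeasurable_iff_measurable_separable.2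
    ⟨hc.measurable.comp g.measurable_left, ?_⟩
  obtain ⟨K, hK, hg⟩ := g.bounded
  refine ((hK.image continuous_fst).image hc).isSeparable.mono ?_
  rintro _ ⟨x, rfl⟩
  exact ⟨_, ⟨_, hg x, rfl⟩, rfl⟩

end Canonical

/-! ### The cocycle of the special representation -/

section Cocycle

variable {𝕜 : Type*} [RCLike 𝕜] {H : Type*} [NormedAddCommGroup H] [InnerProductSpace 𝕜 H]
variable {P₀ : Type*} [Group P₀]

/-- The factor `e^{(1 - a) r / 2} ⟪T(p^r) h, h⟫` that a point `(r, x)` of the gamma process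
contributes to the spherical function of a current with the value `p a` at `x`. -/
noncomputable def sphericalFactor (α : Rpos →* MulAut P₀) (T : P₀ →* (H ≃ₗᵢ[𝕜] H))
    (h : {h : H // ‖h‖ = 1}) (g : P₀ ⋊[α] Rpos) (r : Rpos) : 𝕜 :=
  ((Real.exp ((1 - (g.right : ℝ)) / 2 * r) : ℝ) : 𝕜) * inner 𝕜 h.1 (T (α r g.left) h.1)

variable {α : Rpos →* MulAut P₀} {T : P₀ →* (H ≃ₗᵢ[𝕜] H)} {h : {h : H // ‖h‖ = 1}}

/-- Almost invariance of `h` controls the factor near `r = 0`, and a positive lower bound of the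
scaling parts controls it for large `r`. -/
lemma isGammaMultiplier_sphericalFactor {X : Type*} [MeasurableSpace X] {g : X → P₀ ⋊[α] Rpos}
    (hcont : ∀ x, Continuous fun r => T (α r (g x).left) h.1)
    (hmeas : ∀ r, StronglyMeasurable fun x => T (α r (g x).left) h.1)
    (hright : Measurable fun x => (g x).right) {a b L : ℝ} (ha : 0 < a)
    (hag : ∀ x, a ≤ (g x).right) (hgb : ∀ x, ((g x).right : ℝ) ≤ b)
    (hL : ∀ x, IsAlmostInvariant α T h L (g x).left) :
    IsGammaMultiplier (fun r x => sphericalFactor α T h (g x) r) (max ((1 - a) / 2) 0)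
      ((1 + |b|) / 2 + |L|) where
  nonneg := le_max_right _ _
  lt_one := max_lt (by linarith) one_pos
  const_nonneg := by positivity
  cont x := by
    unfold sphericalFactor
    exact (RCLike.continuous_ofReal.comp (by fun_prop)).mul (continuous_const.inner (hcont x))
  meas r := by
    unfold sphericalFactor
    exact (RCLike.continuous_ofReal.measurable.comp (by fun_prop)).stronglyMeasurable.mul
      (stronglyMeasurable_const.inner (hmeas r))
  norm_le r x := by
    have hr : (0 : ℝ) < r := r.2
    rw [sphericalFactor, norm_mul, RCLike.norm_ofReal, abs_of_pos (Real.exp_pos _)]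
    have h1 : ‖(inner 𝕜 h.1 (T (α r (g x).left) h.1) : 𝕜)‖ ≤ 1 := by
      refine (norm_inner_le_norm _ _).trans ?_
      rw [LinearIsometryEquiv.norm_map, h.2, one_mul]
    refine (mul_le_of_le_one_right (Real.exp_pos _).le h1).trans (Real.exp_le_exp.2 ?_)
    refine mul_le_mul_of_nonneg_right (le_max_of_le_left ?_) hr.le
    linarith [hag x]
  norm_sub_one_le r x := by
    have hr : (0 : ℝ) < r := r.2
    set c : 𝕜 := inner 𝕜 h.1 (T (α r (g x).left) h.1) with hc
    have hκ : (0 : ℝ) ≤ max ((1 - a) / 2) 0 * r := mul_nonneg (le_max_right _ _) hr.le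
    have h1 : ‖c‖ ≤ 1 := by
      refine (norm_inner_le_norm _ _).trans ?_
      rw [LinearIsometryEquiv.norm_map, h.2, one_mul]
    have h2 : ‖c - 1‖ ≤ |L| * r := by
      have e : c - 1 = inner 𝕜 h.1 (T (α r (g x).left) h.1 - h.1) := by
        rw [inner_sub_right, inner_stabilizing_self]
      rw [e]
      refine (norm_inner_le_norm _ _).trans ?_
      rw [h.2, one_mul]
      exact (hL x r).trans (mul_le_mul_of_nonneg_right (le_abs_self L) hr.le)
    have h3 : |Real.exp ((1 - ((g x).right : ℝ)) / 2 * r) - 1|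
        ≤ (1 + |b|) / 2 * r * Real.exp (max ((1 - a) / 2) 0 * r) := by
      refine (abs_exp_sub_one_le_abs_mul_exp (b := max ((1 - a) / 2) 0 * r)
        (mul_le_mul_of_nonneg_right (le_max_of_le_left (by linarith [hag x])) hr.le) hκ).trans ?_
      rw [abs_mul, abs_of_pos hr, abs_div, abs_two]
      gcongr
      refine (abs_sub _ _).trans ?_
      rw [abs_one, abs_of_pos (g x).right.2]
      linarith [hgb x, le_abs_self b]
    have e : sphericalFactor α T h (g x) r - 1
        = ((Real.exp ((1 - ((g x).right : ℝ)) / 2 * r) - 1 : ℝ) : 𝕜) * c + (c - 1) := by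
      rw [sphericalFactor, ← hc]
      push_cast
      ring
    rw [e]
    refine (norm_add_le _ _).trans ?_
    rw [norm_mul, RCLike.norm_ofReal, add_mul]
    refine add_le_add ?_ ?_
    · refine (mul_le_of_le_one_right (abs_nonneg _) h1).trans (h3.trans_eq ?_)
      ring
    · refine h2.trans ?_
      rw [← mul_assoc]
      exact le_mul_of_one_le_right (by positivity) (Real.one_le_exp hκ)

lemma f₀_mul (a r : Rpos) :
    f₀ 𝕜 h (a * r) = ((Real.exp (-((a : ℝ) * r) / 2) : ℝ) : 𝕜) • h.1 := rfl

lemma norm_f₀_sq (r : Rpos) : ‖f₀ 𝕜 h r‖ ^ 2 = Real.exp (-(r : ℝ)) := by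
  rw [f₀, norm_smul, h.2, mul_one, RCLike.norm_ofReal, abs_of_pos (Real.exp_pos _),
    ← Real.exp_nat_mul]
  congr 1
  push_cast
  ring

lemma inner_f₀_apply_f₀ (g : P₀ ⋊[α] Rpos) (r : Rpos) :
    (inner 𝕜 (f₀ 𝕜 h r) (T (α r g.left) (f₀ 𝕜 h (g.right * r))) : 𝕜)
      = ((Real.exp (-(r : ℝ)) : ℝ) : 𝕜) * sphericalFactor α T h g r := by
  rw [f₀_mul, f₀, map_smul, inner_smul_left, inner_smul_right, RCLike.conj_ofReal, sphericalFactor,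
    ← mul_assoc, ← mul_assoc, ← RCLike.ofReal_mul, ← RCLike.ofReal_mul, ← Real.exp_add,
    ← Real.exp_add]
  ring_nf

/-- `⟨b(g), f₀⟩` is the integral of `e^{-r} (F - 1)` for the spherical factor `F`. -/
lemma inner_f₀_cocycle (g : P₀ ⋊[α] Rpos) (r : Rpos) :
    (inner 𝕜 (f₀ 𝕜 h r) (cocycle α T h g r) : 𝕜)
      = Real.exp (-(r : ℝ)) • (sphericalFactor α T h g r - 1) := by
  rw [cocycle, specialRep, inner_sub_right, inner_f₀_apply_f₀, inner_self_eq_norm_sq_to_K,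
    ← RCLike.ofReal_pow, norm_f₀_sq, RCLike.real_smul_eq_coe_mul]
  ring

/-- `‖b‖² = ‖T̃(g) f₀‖² - ‖f₀‖² - 2 Re ⟨b, f₀⟩` at each point `r`. -/
lemma norm_cocycle_sq (g : P₀ ⋊[α] Rpos) (r : Rpos) :
    ‖cocycle α T h g r‖ ^ 2 = Real.exp (-(r : ℝ)) • ((Real.exp ((1 - (g.right : ℝ)) * r) - 1)
      - 2 * RCLike.re (sphericalFactor α T h g r - 1)) := by
  rw [cocycle, specialRep, norm_sub_sq (𝕜 := 𝕜), LinearIsometryEquiv.norm_map, norm_f₀_sq,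
    norm_f₀_sq, ← inner_re_symm, inner_f₀_apply_f₀, RCLike.re_ofReal_mul, map_sub, RCLike.one_re]
  have e : Real.exp (-((g.right * r : Rpos) : ℝ))
      = Real.exp (-(r : ℝ)) * Real.exp ((1 - (g.right : ℝ)) * r) := by
    rw [← Real.exp_add]
    congr 1
    change -((g.right : ℝ) * r) = _
    ring
  rw [e, smul_eq_mul]
  ring

lemma levyPos_eq_withDensity :
    levyPos = haarPos.withDensity fun r => ENNReal.ofReal (Real.exp (-(r : ℝ))) := by
  rw [levyPos, haarPos, ← withDensity_mul _ (by fun_prop) (by fun_prop)]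
  congr 1
  ext r
  rw [Pi.mul_apply, ← ENNReal.ofReal_mul (inv_nonneg.2 r.2.le)]

lemma integrable_haarPos_exp_smul_iff {E : Type*} [NormedAddCommGroup E] [NormedSpace ℝ E]
    {f : Rpos → E} :
    Integrable (fun r : Rpos => Real.exp (-(r : ℝ)) • f r) haarPos ↔ Integrable f levyPos := by
  have h1 : (fun r : Rpos => ENNReal.ofReal (Real.exp (-(r : ℝ))))
      = fun r : Rpos => ((Real.exp (-(r : ℝ))).toNNReal : ℝ≥0∞) := rfl
  rw [levyPos_eq_withDensity, h1, integrable_withDensity_iff_integrable_smul (by fun_prop)]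
  simp_rw [NNReal.smul_def, Real.coe_toNNReal _ (Real.exp_pos _).le]

lemma integral_haarPos_exp_smul {E : Type*} [NormedAddCommGroup E] [NormedSpace ℝ E]
    (f : Rpos → E) :
    ∫ r : Rpos, Real.exp (-(r : ℝ)) • f r ∂haarPos = ∫ r, f r ∂levyPos := by
  rw [levyPos_eq_withDensity, integral_withDensity_eq_integral_toReal_smul (by fun_prop) (by simp)]
  simp_rw [ENNReal.toReal_ofReal (Real.exp_pos _).le]

variable {g : P₀ ⋊[α] Rpos}

lemma integrable_sphericalFactor_sub_one (hcont : Continuous fun r => T (α r g.left) h.1) {L : ℝ}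
    (hL : IsAlmostInvariant α T h L g.left) :
    Integrable (fun r => sphericalFactor α T h g r - 1) levyPos := by
  have hF := isGammaMultiplier_sphericalFactor (X := Unit) (g := fun _ => g) (fun _ => hcont)
    (fun _ => stronglyMeasurable_const) measurable_const g.right.2 (fun _ => le_rfl)
    (fun _ => le_rfl) (fun _ => hL)
  exact Integrable.mono' ((integrable_mul_exp_mul_levyPos hF.lt_one).const_mul _)
    ((hF.cont ()).sub continuous_const).aestronglyMeasurable
    (Eventually.of_forall fun r => hF.norm_sub_one_le r ())

lemma integrable_inner_f₀_cocycle
    (hi : Integrable (fun r => sphericalFactor α T h g r - 1) levyPos) :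
    Integrable (fun r => (inner 𝕜 (f₀ 𝕜 h r) (cocycle α T h g r) : 𝕜)) haarPos := by
  simp_rw [inner_f₀_cocycle]
  exact integrable_haarPos_exp_smul_iff.2 hi

lemma integrable_exp_one_sub_sub_one (a : Rpos) :
    Integrable (fun r : Rpos => Real.exp ((1 - (a : ℝ)) * r) - 1) levyPos :=
  integrable_exp_sub_one_levyPos (by linarith [a.2])

lemma memLp_cocycle (hcont : Continuous fun r => T (α r g.left) h.1)
    (hi : Integrable (fun r => sphericalFactor α T h g r - 1) levyPos) :
    MemLp (cocycle α T h g) 2 haarPos := by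
  have hc : Continuous (cocycle α T h g) := by
    have e : cocycle α T h g = fun r : Rpos => ((Real.exp (-((g.right : ℝ) * r) / 2) : ℝ) : 𝕜)
        • T (α r g.left) h.1 - ((Real.exp (-(r : ℝ) / 2) : ℝ) : 𝕜) • h.1 := by
      ext r
      rw [cocycle, specialRep, f₀_mul, map_smul, f₀]
    rw [e]
    refine Continuous.sub (Continuous.smul ?_ hcont) (Continuous.smul ?_ continuous_const) <;>
    exact RCLike.continuous_ofReal.comp (by fun_prop)
  rw [memLp_two_iff_integrable_sq_norm hc.aestronglyMeasurable]
  simp_rw [norm_cocycle_sq]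
  exact integrable_haarPos_exp_smul_iff.2
    ((integrable_exp_one_sub_sub_one _).sub (hi.re.const_mul 2))

/-- The exponent of the spherical function is the Campbell exponent of the factor
`e^{(1 - a) r / 2} ⟪T(p^r) h, h⟫`, corrected by `½ log a`. By Frullani's integral the latter is the
difference between `-½ ‖b(g)‖²` and the real part of `⟨b(g), f₀⟩`. -/
lemma sphericalExponent_eq
    (hi : Integrable (fun r => sphericalFactor α T h g r - 1) levyPos) :
    sphericalExponent α T h g = ∫ r, (sphericalFactor α T h g r - 1) ∂levyPos
      + ((1 / 2 * Real.log g.right : ℝ) : 𝕜) := by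
  have h1 : cocyclePairing α T h g = ∫ r, (sphericalFactor α T h g r - 1) ∂levyPos := by
    simp_rw [cocyclePairing, inner_f₀_cocycle]
    exact integral_haarPos_exp_smul _
  have h2 : cocycleNormSq α T h g = -Real.log g.right
      - 2 * RCLike.re (∫ r, (sphericalFactor α T h g r - 1) ∂levyPos) := by
    simp_rw [cocycleNormSq, norm_cocycle_sq]
    rw [integral_haarPos_exp_smul (fun r : Rpos => (Real.exp ((1 - (g.right : ℝ)) * r) - 1)
      - 2 * RCLike.re (sphericalFactor α T h g r - 1)), integral_sub
      (integrable_exp_one_sub_sub_one _) (hi.re.const_mul 2), integral_const_mul, integral_re hi,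
      integral_exp_sub_one_levyPos (by linarith [g.right.2])]
    congr 3
    ring
  rw [sphericalExponent, h1, h2]
  set J : 𝕜 := ∫ r, (sphericalFactor α T h g r - 1) ∂levyPos
  conv_rhs => rw [← RCLike.re_add_im J]
  push_cast
  ring

end Cocycle

/-! ### The spherical function of the integral model -/

section IntegralModel

variable {𝕜 : Type*} [RCLike 𝕜] {H : Type*} [NormedAddCommGroup H] [InnerProductSpace 𝕜 H]
variable {h : {h : H // ‖h‖ = 1}} {X : Type*}

lemma exists_vacuum_eq (ω : Config X) :
    ∃ f : Family h.1, vacuum 𝕜 h ω = tmk 𝕜 f ∧ ∀ k, f.1 k = f₀ 𝕜 h (ω.r k) :=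
  ⟨⟨_, _⟩, rfl, fun _ => rfl⟩

/-- The norm of an elementary tensor with factors of norm `e^{-s_k / 2}`. -/
lemma norm_tmk_sq {f : Family h.1} {s : ℕ → ℝ} (hs : Summable s)
    (hf : ∀ k, ‖f.1 k‖ ^ 2 = Real.exp (-s k)) : ‖tmk 𝕜 f‖ ^ 2 = Real.exp (-∑' k, s k) := by
  have h1 : HasProd (fun k => (inner 𝕜 (f.1 k) (f.1 k) : 𝕜))
      ((Real.exp (-∑' k, s k) : ℝ) : 𝕜) := by
    have := (hs.hasSum.neg.rexp).map (algebraMap ℝ 𝕜) RCLike.continuous_ofReal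
    refine this.congr_fun fun k => ?_
    simp only [Function.comp, RCLike.algebraMap_eq_ofReal]
    rw [inner_self_eq_norm_sq_to_K, ← RCLike.ofReal_pow, hf]
  rw [← inner_self_eq_norm_sq (𝕜 := 𝕜), inner_tmk, h1.tprod_eq, RCLike.ofReal_re]

lemma norm_vacuum_sq (ω : Config X) :
    ‖vacuum 𝕜 h ω‖ ^ 2 = Real.exp (-∑' k, (ω.r k : ℝ)) := by
  obtain ⟨f, hf, hfk⟩ := exists_vacuum_eq (𝕜 := 𝕜) (h := h) ω
  rw [hf]
  exact norm_tmk_sq ω.2 fun k => by rw [hfk, norm_f₀_sq]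

lemma continuous_f₀ : Continuous (f₀ 𝕜 h) := by
  unfold f₀
  exact (RCLike.continuous_ofReal.comp (by fun_prop)).smul continuous_const

variable [MeasurableSpace X] {m : Measure X}

lemma isSection_of_family (c : 𝕜) {f : Config X → Family h.1} {v : Rpos × X → H}
    (hv : StronglyMeasurable v) (hf : ∀ ω k, (f ω).1 k = v (ω.r k, ω.x k)) :
    IsSection h (fun ω => c • tmk 𝕜 (f ω)) := by
  refine ⟨(stronglyMeasurable_tmk fun k => ?_).const_smul c, fun σ ω => ?_⟩
  · simp_rw [hf]
    exact hv.comp_measurable ((measurable_config_r k).prodMk (measurable_config_x k))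
  · have e : f (ω.reindex σ) = (f ω).reindex σ := by
      refine Subtype.ext (funext fun k => ?_)
      change (f (ω.reindex σ)).1 k = (f ω).1 (σ k)
      rw [hf, hf]
      rfl
    rw [map_smul, permOp_tmk, ← e]

lemma integral_lebesgueInf {E : Type*} [NormedAddCommGroup E] [NormedSpace ℝ E]
    (G : Config X → E) :
    ∫ ω, G ω ∂(lebesgueInf m) = ∫ ω, Real.exp (∑' k, (ω.r k : ℝ)) • G ω ∂(gammaMeasure m) := by
  have hm := measurable_config_total (X := X)
  rw [lebesgueInf, integral_withDensity_eq_integral_toReal_smul (by fun_prop) (by simp)]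
  simp_rw [ENNReal.toReal_ofReal (Real.exp_pos _).le]

/-- A section with `‖F(ξ)‖² = c e^{-∑ rₖ f(xₖ)}` is square-integrable, by the Laplace transform
of `𝓛`. -/
lemma memLp_of_norm_sq_eq [IsProbabilityMeasure m] {F : Config X → InfTensor 𝕜 h}
    (hF : StronglyMeasurable F) {c a b : ℝ}
    {f : X → ℝ} (hf : Measurable f) (ha : 0 < a) (hab : ∀ x, a ≤ f x ∧ f x ≤ b)
    (hn : ∀ ω, ‖F ω‖ ^ 2 = c * Real.exp (-∑' k, (ω.r k : ℝ) * f (ω.x k))) :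
    MemLp F 2 (lebesgueInf m) ∧
      ∫ ω, ‖F ω‖ ^ 2 ∂(lebesgueInf m) = c * Real.exp (-∫ x, Real.log (f x) ∂m) := by
  have hm : Measurable fun ω : Config X => Real.exp (-∑' k, (ω.r k : ℝ) * f (ω.x k)) := by
    have : Measurable fun ω : Config X => ∑' k, (ω.r k : ℝ) * f (ω.x k) :=
      Measurable.tsum fun k => by fun_prop
    fun_prop
  have hl := lintegral_lebesgueInf m hf ha hab
  have hi : Integrable (fun ω : Config X => Real.exp (-∑' k, (ω.r k : ℝ) * f (ω.x k)))
      (lebesgueInf m) := by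
    refine ⟨hm.aestronglyMeasurable, ?_⟩
    rw [hasFiniteIntegral_iff_ofReal (Eventually.of_forall fun _ => (Real.exp_pos _).le), hl]
    exact ENNReal.ofReal_lt_top
  rw [memLp_two_iff_integrable_sq_norm hF.aestronglyMeasurable]
  simp_rw [hn]
  refine ⟨hi.const_mul c, ?_⟩
  rw [integral_const_mul, integral_eq_lintegral_of_nonneg_ae
    (Eventually.of_forall fun _ => (Real.exp_pos _).le) hm.aestronglyMeasurable, hl,
    ENNReal.toReal_ofReal (Real.exp_pos _).le]

lemma isSection_vacuum : IsSection h (vacuum 𝕜 h : Config X → InfTensor 𝕜 h) := by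
  choose f hf hfk using exists_vacuum_eq (𝕜 := 𝕜) (h := h) (X := X)
  have e : (vacuum 𝕜 h : Config X → InfTensor 𝕜 h) = fun ω => (1 : 𝕜) • tmk 𝕜 (f ω) := by
    ext ω
    rw [one_smul, hf]
  rw [e]
  exact isSection_of_family 1 (v := fun q => f₀ 𝕜 h q.1)
    (continuous_f₀.stronglyMeasurable.comp_measurable measurable_fst) hfk

lemma vacuum_memLp_and_integral [IsProbabilityMeasure m] : MemLp (vacuum 𝕜 h) 2 (lebesgueInf m) ∧
    ∫ ω, ‖vacuum 𝕜 h ω‖ ^ 2 ∂(lebesgueInf m) = 1 := by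
  have := memLp_of_norm_sq_eq (m := m) (isSection_vacuum (𝕜 := 𝕜) (h := h)).1 (c := 1) (a := 1)
    (b := 1) (f := fun _ => 1) measurable_const one_pos (fun _ => ⟨le_rfl, le_rfl⟩)
    (fun ω => by simp [norm_vacuum_sq])
  simpa using this

lemma isSqSection_vacuum (m : Measure X) [IsProbabilityMeasure m] :
    IsSqSection h m (vacuum 𝕜 h) :=
  ⟨isSection_vacuum, vacuum_memLp_and_integral.1⟩

/-- The inner product of the vectors of `INT H` given by two sections. -/
lemma inner_toInt {F G : Config X → InfTensor 𝕜 h} (hF : IsSqSection h m F)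
    (hG : IsSqSection h m G) :
    (inner 𝕜 hF.toInt hG.toInt : 𝕜) = ∫ ω, inner 𝕜 (F ω) (G ω) ∂(lebesgueInf m) := by
  rw [Submodule.coe_inner, L2.inner_def]
  refine integral_congr_ae ?_
  filter_upwards [hF.2.coeFn_toLp, hG.2.coeFn_toLp] with ω h1 h2
  change inner 𝕜 (hF.2.toLp F ω) (hG.2.toLp G ω) = _
  rw [h1, h2]

lemma norm_toInt_vacuum [IsProbabilityMeasure m] (hΩ : IsSqSection h m (vacuum 𝕜 h)) :
    ‖hΩ.toInt‖ = 1 := by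
  have h1 : ((‖hΩ.toInt‖ ^ 2 : ℝ) : 𝕜) = ((1 : ℝ) : 𝕜) := by
    rw [RCLike.ofReal_pow, ← inner_self_eq_norm_sq_to_K, inner_toInt,
      ← (vacuum_memLp_and_integral (𝕜 := 𝕜) (h := h) (m := m)).2, ← integral_ofReal]
    simp_rw [inner_self_eq_norm_sq_to_K, RCLike.ofReal_pow]
  have h2 : ‖hΩ.toInt‖ ^ 2 = 1 := RCLike.ofReal_injective h1
  exact (pow_eq_one_iff_of_nonneg (norm_nonneg _) two_ne_zero).1 h2

variable {P₀ : Type*} [Group P₀] [TopologicalSpace P₀] [MeasurableSpace P₀]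
variable {α : Rpos →* MulAut P₀} {T : P₀ →* (H ≃ₗᵢ[𝕜] H)} {g : Current α X} {L : ℝ}

/-- The scalar factor `e^{½ ∫ log r₀ dm}` of the operator of a current. -/
noncomputable def currentScalar (m : Measure X) (g : Current α X) : ℝ :=
  Real.exp (1 / 2 * ∫ x, Real.log (g.toFun x).right ∂m)

/-- `U(g) Ω` is the elementary tensor with the factors `T(p(xₖ)^{rₖ}) f₀(r₀(xₖ) rₖ)`, multiplied by
the scalar factor of `g`. -/
lemma exists_intRep_vacuum_eq (hL : ∀ x, IsAlmostInvariant α T h L (g.toFun x).left)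
    (ω : Config X) : ∃ f : Family h.1,
      intRep α T m g (vacuum 𝕜 h) ω = ((currentScalar m g : ℝ) : 𝕜) • tmk 𝕜 f ∧
      ∀ k, f.1 k = T (α (ω.r k) (g.toFun (ω.x k)).left)
        (f₀ 𝕜 h ((g.toFun (ω.x k)).right * ω.r k)) := by
  have hA : Summable fun k => ‖T (α (ω.r k) (g.toFun (ω.x k)).left) h.1 - h.1‖ :=
    Summable.of_nonneg_of_le (fun _ => norm_nonneg _) (fun k => hL (ω.x k) (ω.r k))
      (ω.2.mul_left L)
  obtain ⟨f, hf, hfk⟩ := exists_vacuum_eq (𝕜 := 𝕜) (h := h)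
    (ω.scale (fun x => (g.toFun x).right) g.exists_right_le)
  refine ⟨f.act _ hA, ?_, fun k => congrArg _ (hfk k)⟩
  rw [intRep, hf, tensorOp_tmk _ hA]
  rfl

/-- `⟪U(g) Ω, Ω⟫` at a configuration, times the density `e^{∑ rₖ}` of `𝓛`, is a multiplicative
functional of the configuration. -/
lemma inner_vacuum_intRep_vacuum (hL : ∀ x, IsAlmostInvariant α T h L (g.toFun x).left)
    {κ C : ℝ} (hF : IsGammaMultiplier (fun r x => sphericalFactor α T h (g.toFun x) r) κ C)
    (ω : Config X) :
    Real.exp (∑' k, (ω.r k : ℝ)) •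
        (inner 𝕜 (vacuum 𝕜 h ω) (intRep α T m g (vacuum 𝕜 h) ω) : 𝕜)
      = ((currentScalar m g : ℝ) : 𝕜) *
        ∏' k, sphericalFactor α T h (g.toFun (ω.x k)) (ω.r k) := by
  obtain ⟨f, hf, hfk⟩ := exists_intRep_vacuum_eq (m := m) hL ω
  obtain ⟨f', hf', hfk'⟩ := exists_vacuum_eq (𝕜 := 𝕜) (h := h) ω
  have h1 : HasProd (fun k => ((Real.exp (-(ω.r k : ℝ)) : ℝ) : 𝕜))
      ((Real.exp (-∑' k, (ω.r k : ℝ)) : ℝ) : 𝕜) :=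
    (ω.2.hasSum.neg.rexp).map (algebraMap ℝ 𝕜) RCLike.continuous_ofReal
  have h2 := (h1.mul (hF.multipliable ω).hasProd).tprod_eq
  rw [hf, hf', inner_smul_right, inner_tmk]
  simp_rw [hfk, hfk', inner_f₀_apply_f₀]
  rw [h2, RCLike.real_smul_eq_coe_mul, mul_left_comm, ← mul_assoc (_ : 𝕜) _ (∏' k, _),
    ← RCLike.ofReal_mul, ← Real.exp_add]
  simp

/-- `U(g) Ω` is square-integrable because `‖U(g) Ω‖²` is a multiple of `e^{-∑ r₀(xₖ) rₖ}`, which the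
Laplace transform of `𝓛` integrates. -/
lemma isSqSection_intRep_vacuum [IsProbabilityMeasure m]
    (hmeas : StronglyMeasurable fun q : Rpos × X => T (α q.1 (g.toFun q.2).left) h.1)
    (hL : ∀ x, IsAlmostInvariant α T h L (g.toFun x).left) {a b : ℝ} (ha : 0 < a)
    (hab : ∀ x, a ≤ (g.toFun x).right ∧ ((g.toFun x).right : ℝ) ≤ b) :
    IsSqSection h m (intRep α T m g (vacuum 𝕜 h)) := by
  choose f hf hfk using exists_intRep_vacuum_eq (m := m) hL
  have e : intRep α T m g (vacuum 𝕜 h)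
      = fun ω => ((currentScalar m g : ℝ) : 𝕜) • tmk 𝕜 (f ω) := funext hf
  have hr := g.measurable_right
  have hsec : IsSection h (intRep α T m g (vacuum 𝕜 h)) := by
    rw [e]
    refine isSection_of_family _ (v := fun q : Rpos × X =>
      ((Real.exp (-(((g.toFun q.2).right : ℝ) * q.1) / 2) : ℝ) : 𝕜)
        • T (α q.1 (g.toFun q.2).left) h.1) (StronglyMeasurable.smul ?_ hmeas) fun ω k => ?_
    · have hr2 : Measurable fun q : Rpos × X => ((g.toFun q.2).right : ℝ) :=
        measurable_subtype_coe.comp (hr.comp measurable_snd)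
      exact (RCLike.continuous_ofReal.measurable.comp (by fun_prop)).stronglyMeasurable
    · rw [hfk, f₀_mul, map_smul]
  refine ⟨hsec, (memLp_of_norm_sq_eq (f := fun x => ((g.toFun x).right : ℝ)) hsec.1
    (c := currentScalar m g ^ 2) (by fun_prop) ha hab fun ω => ?_).1⟩
  rw [hf, norm_smul, mul_pow, RCLike.norm_ofReal, sq_abs]
  congr 1
  refine norm_tmk_sq (ω.summable_mul (f := fun x => ((g.toFun x).right : ℝ)) (b := b) fun x => ?_)
    fun k => ?_
  · rw [abs_of_pos (g.toFun x).right.2]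
    exact (hab x).2
  · rw [hfk, LinearIsometryEquiv.norm_map, norm_f₀_sq, mul_comm]
    rfl

lemma integrable_log_right [IsProbabilityMeasure m] {a b : ℝ} (ha : 0 < a)
    (hab : ∀ x, a ≤ (g.toFun x).right ∧ ((g.toFun x).right : ℝ) ≤ b) :
    Integrable (fun x => Real.log (g.toFun x).right) m := by
  have hr := g.measurable_right
  refine Integrable.of_bound (C := max |Real.log a| |Real.log b|)
    (by fun_prop : Measurable fun x => Real.log (g.toFun x).right).aestronglyMeasurable
    (Eventually.of_forall fun x => ?_)
  exact abs_le_max_abs_abs (Real.log_le_log ha (hab x).1)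
    (Real.log_le_log (g.toFun x).right.2 (hab x).2)

/-- The spherical function of the integral model: Campbell's formula for the spherical factors, with
the exponent rewritten in terms of the cocycle. -/
theorem integrable_and_inner_intRep [IsProbabilityMeasure m]
    (hmeas : StronglyMeasurable fun q : Rpos × X => T (α q.1 (g.toFun q.2).left) h.1)
    (hcont : ∀ x, Continuous fun r => T (α r (g.toFun x).left) h.1)
    (hL : ∀ x, IsAlmostInvariant α T h L (g.toFun x).left) {a b : ℝ} (ha : 0 < a)
    (hab : ∀ x, a ≤ (g.toFun x).right ∧ ((g.toFun x).right : ℝ) ≤ b)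
    (hΩ : IsSqSection h m (vacuum 𝕜 h)) (hU : IsSqSection h m (intRep α T m g (vacuum 𝕜 h))) :
    Integrable (fun x => sphericalExponent α T h (g.toFun x)) m ∧
      (inner 𝕜 hΩ.toInt hU.toInt : 𝕜)
        = NormedSpace.exp (∫ x, sphericalExponent α T h (g.toFun x) ∂m) := by
  have hF := isGammaMultiplier_sphericalFactor (g := g.toFun) hcont
    (fun r => hmeas.comp_measurable (measurable_const.prodMk measurable_id)) g.measurable_right ha
    (fun x => (hab x).1) (fun x => (hab x).2) hL
  have hlog := (integrable_log_right (m := m) ha hab).const_mul (1 / 2)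
  have hJ : Integrable (fun x => ∫ r, (sphericalFactor α T h (g.toFun x) r - 1) ∂levyPos) m :=
    (hF.integrable_levy (m := m)).integral_prod_right
  have hexp : (fun x => sphericalExponent α T h (g.toFun x))
      = fun x => ∫ r, (sphericalFactor α T h (g.toFun x) r - 1) ∂levyPos
        + ((1 / 2 * Real.log (g.toFun x).right : ℝ) : 𝕜) :=
    funext fun x => sphericalExponent_eq (integrable_sphericalFactor_sub_one (hcont x) (hL x))
  rw [hexp]
  refine ⟨hJ.add hlog.ofReal, ?_⟩
  rw [integral_add hJ hlog.ofReal, integral_ofReal, integral_const_mul, NormedSpace.exp_add,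
    inner_toInt, integral_lebesgueInf]
  simp_rw [inner_vacuum_intRep_vacuum hL hF]
  rw [integral_const_mul, hF.integral_tprod.2, integral_prod_symm _ hF.integrable_levy, mul_comm,
    currentScalar, Real.exp_eq_exp_ℝ]
  congr 1
  exact NormedSpace.algebraMap_exp_comm (𝔸 := 𝕜) _

end IntegralModel

end IntModel

theorem mainTheorem5 {𝕜 : Type*} [RCLike 𝕜]
    {H : Type*} [NormedAddCommGroup H] [InnerProductSpace 𝕜 H] [CompleteSpace H]
    {P₀ : Type*} [Group P₀] [TopologicalSpace P₀] [IsTopologicalGroup P₀] [LocallyCompactSpace P₀]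
    [MeasurableSpace P₀] [BorelSpace P₀]
    {X : Type*} [MeasurableSpace X] (m : Measure X) [IsProbabilityMeasure m]
    (α : Rpos →* MulAut P₀) (hα : Continuous fun q : Rpos × P₀ => α q.1 q.2)
    (T : P₀ →* (H ≃ₗᵢ[𝕜] H)) (hTcont : ∀ v : H, Continuous fun p : P₀ => T p v)
    (h : {h : H // ‖h‖ = 1}) (hT : IsCanonical α T h) :
    -- `𝓛` is the infinite-dimensional Lebesgue measure: its Laplace transform
    (∀ f : X → ℝ, Measurable f → (∃ a b : ℝ, 0 < a ∧ ∀ x, a ≤ f x ∧ f x ≤ b) →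
      ∫⁻ ω, ENNReal.ofReal (Real.exp (-∑' k, (ω.r k : ℝ) * f (ω.x k))) ∂(lebesgueInf m)
        = ENNReal.ofReal (Real.exp (-∫ x, Real.log (f x) ∂m))) ∧
    -- the norm of `b(p)` and the pairing of `b(p)` with `f₀` are finite
    (∀ p : P₀ ⋊[α] Rpos, MemLp (cocycle α T h p) 2 haarPos ∧
      Integrable (fun r => (inner 𝕜 (f₀ 𝕜 h r) (cocycle α T h p r) : 𝕜)) haarPos) ∧
    -- `Ω` is a unit vector of `INT H`, and the spherical function
    ∃ hΩ : IsSqSection h m (vacuum 𝕜 h), ‖hΩ.toInt‖ = 1 ∧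
      ∀ g : Current α X,
        Integrable (fun x => sphericalExponent α T h (g.toFun x)) m ∧
        ∃ hU : IsSqSection h m (intRep α T m g (vacuum 𝕜 h)),
          (inner 𝕜 hΩ.toInt hU.toInt : 𝕜)
            = NormedSpace.exp (∫ x, sphericalExponent α T h (g.toFun x) ∂m) := by
  have hcont : ∀ p : P₀, Continuous fun r => T (α r p) h.1 := fun p =>
    (continuous_apply_stabilizing (h := h) hα hTcont).comp
      (by fun_prop : Continuous fun r : Rpos => (r, p))
  refine ⟨fun f hf ⟨a, b, ha, hab⟩ => lintegral_lebesgueInf m hf ha hab, fun p => ?_,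
    isSqSection_vacuum m, norm_toInt_vacuum _, fun g => ?_⟩
  · obtain ⟨L, hL⟩ := hT.exists_isAlmostInvariant p.left
    have hi := integrable_sphericalFactor_sub_one (hcont p.left) hL
    exact ⟨memLp_cocycle (hcont p.left) hi, integrable_inner_f₀_cocycle hi⟩
  · obtain ⟨K, hK, hg⟩ := g.bounded
    obtain ⟨L, hL⟩ := hT.exists_isAlmostInvariant_of_isCompact hα hTcont (hK.image continuous_fst)
    have hgL : ∀ x, IsAlmostInvariant α T h L (g.toFun x).left := fun x => hL _ ⟨_, hg x, rfl⟩
    obtain ⟨a, ha, hag⟩ := g.exists_le_right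
    obtain ⟨b, hgb⟩ := g.exists_right_le
    have hmeas := g.stronglyMeasurable_apply (h := h) hα hTcont
    have hab := fun x => And.intro (hag x) (hgb x)
    have hU := isSqSection_intRep_vacuum (m := m) hmeas hgL ha hab
    obtain ⟨h1, h2⟩ := integrable_and_inner_intRep hmeas (fun x => hcont _) hgL ha hab
      (isSqSection_vacuum m) hU
    exact ⟨h1, hU, h2⟩
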